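/- Let $\mathbf k=\mathbb R$ or $\mathbb C$; manifolds are finite dimensional and smooth if $\mathbf k=\mathbb R$, complex if $\mathbf k=\mathbb C$, and tensor fields are correspondingly smooth or holomorphic. Let $\mathfrak g$ be a finite dimensional Lie algebra over $\mathbf k$ and let $r=\sum_i x_i\otimes y_i\in\mathfrak g\otimes\mathfrak g$ be a quasitriangular $r$-matrix, i.e. the symmetric part of $r$ is $\mathrm{ad}$-invariant and $[r_{12},r_{13}]+[r_{12},r_{23}]+[r_{13},r_{23}]=0$. Write $r^{21}=\sum_i y_i\otimes x_i$ and $\delta_r(x)=\mathrm{ad}_x r$. A left action of $\mathfrak g$ on a manifold $Y$ is a Lie algebra anti-homomorphism $\lambda$ from $\mathfrak g$ to the vector fields on $Y$; for $t=\sum_i u_i\otimes v_i\in\mathfrak g\otimes\mathfrak g$ put $\lambda(t)=\sum_i\lambda(u_i)\otimes\lambda(v_i)$. A left $(\mathfrak g,r)$-Poisson space is a triple $(Y,\pi,\lambda)$ where $r$ is a quasitriangular $r$-matrix on $\mathfrak g$, $\pi$ is a Poisson structure on the manifold $Y$ (a bivector field with Schouten bracket $[\pi,\pi]=0$), and $\lambda$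 is a left action of $\mathfrak g$ on $Y$ such that $[\lambda(x),\pi]=\lambda(\delta_r(x))$ for all $x\in\mathfrak g$. For $n\ge 1$, $1\le j\le n$ and $X\in\mathfrak g^{\otimes k}$, let $(X)_j\in(\mathfrak g^n)^{\otimes k}$ be the image of $X$ under the inclusion of $\mathfrak g$ as the $j$-th summand of the direct product Lie algebra $\mathfrak g^n$, and, with $u\wedge v=u\otimes v-v\otimes u$, let $$\mathrm{Alt}^n(r)=\sum_{j\ \mathrm{odd}}(r)_j-\sum_{j\ \mathrm{even}}(r^{21})_j,\qquad \mathrm{Mix}^n(r)=\sum_{1\le j<k\le n}\sum_i (y_i)_j\wedge(x_i)_k,\qquad r^{(n)}=\mathrm{Alt}^n(r)-\mathrm{Mix}^n(r).$$ Let $(Y_j,\pi_j,\lambda_j)$, $1\le j\le n$, be left $(\mathfrak g,r)$-Poisson spaces, let $Y=Y_1\times\cdots\times Y_n$, let $\lambda(x_1,\dots,x_n)=(\lambda_1(x_1),\dots,\lambda_n(x_n))$ be the direct product action of $\mathfrak g^n$ on $Y$, and let $\lambda_{\rm diag}(x)=(\lambda_1(x),\dots,\lambda_n(x))$ be the diagonal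 action of $\mathfrak g$ on $Y$. Set $$\pi_Y=(\pi_1,\dots,\pi_n)+\lambda(\mathrm{Mix}^n(r)),$$ where $(\pi_1,\dots,\pi_n)$ is the direct product Poisson structure. Then: 1. $(Y,\pi_Y,\lambda)$ is a left $(\mathfrak g^n,r^{(n)})$-Poisson space; in particular $\pi_Y$ is a Poisson structure on $Y$ and $r^{(n)}$ is a quasitriangular $r$-matrix on $\mathfrak g^n$. 2. $(Y,\pi_Y,\lambda_{\rm diag})$ is a left $(\mathfrak g,r)$-Poisson space. 3. If $\pi_j=-\lambda_j(r)$ for all $j$, then $\pi_Y=-\lambda(r^{(n)})$. -/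

import Mathlib

open scoped TensorProduct Manifold ContDiff

noncomputable section

namespace PoissonFusion

/-! ## Finite products of Lie algebras and of manifolds -/

section PiLie

variable {ι : Type*}

/-- The direct product of a family of Lie rings, with the componentwise bracket. -/
instance piLieRing {L : ι → Type*} [∀ i, LieRing (L i)] : LieRing (∀ i, L i) where
  bracket x y := fun i => ⁅x i, y i⁆
  add_lie x y z := funext fun i => add_lie (x i) (y i) (z i)
  lie_add x y z := funext fun i => lie_add (x i) (y i) (z i)
  lie_self x := funext fun i => lie_self (x i)
  leibniz_lie x y z := funext fun i => leibniz_lie (x i) (y i) (z i)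

/-- The direct product of a family of Lie algebras. -/
instance piLieAlgebra {𝕜 : Type*} [CommRing 𝕜] {L : ι → Type*} [∀ i, LieRing (L i)]
    [∀ i, LieAlgebra 𝕜 (L i)] : LieAlgebra 𝕜 (∀ i, L i) where
  lie_smul t x y := funext fun i => lie_smul t (x i) (y i)

end PiLie

section PiManifold

variable {𝕜 : Type*} [NontriviallyNormedField 𝕜] {ι : Type*} [Fintype ι]
  {E : ι → Type*} [∀ i, NormedAddCommGroup (E i)] [∀ i, NormedSpace 𝕜 (E i)]
  {H : ι → Type*} [∀ i, TopologicalSpace (H i)] {I : ∀ i, ModelWithCorners 𝕜 (E i) (H i)}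
  {M : ι → Type*} [∀ i, TopologicalSpace (M i)] [∀ i, ChartedSpace (H i) (M i)]

/-- A finite product of `C^k` manifolds is a `C^k` manifold. -/
instance isManifold_pi {k : ℕ∞ω} [∀ i, IsManifold (I i) k (M i)] :
    IsManifold (ModelWithCorners.pi I) k (∀ i, M i) := by
  refine isManifold_of_contDiffOn _ _ _ ?_
  rintro _ _ ⟨e, he, rfl⟩ ⟨e', he', rfl⟩
  rw [contDiffOn_pi]
  intro i
  have h := (HasGroupoid.compatible (G := contDiffGroupoid k (I i))
    (he i (Set.mem_univ i)) (he' i (Set.mem_univ i)))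
  have h1 := ((mem_groupoid_of_pregroupoid.mp h).1 : ContDiffOn _ _ _ _)
  refine ContDiffOn.comp (t := (I i).symm ⁻¹' ((e i).symm.trans (e' i)).source ∩ Set.range (I i))
    (g := (I i) ∘ ((e i).symm.trans (e' i)) ∘ (I i).symm) (f := fun x : ∀ i, E i => x i) h1
    (ContinuousLinearMap.proj (R := 𝕜) (φ := E) i).contDiff.contDiffOn ?_
  rintro x ⟨⟨hx1, hx2⟩, y, rfl⟩
  exact ⟨⟨hx1 i (Set.mem_univ i), hx2 i (Set.mem_univ i)⟩, y i, rfl⟩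

end PiManifold

/-! ## Quasitriangular `r`-matrices -/

section RMatrix

variable (𝕜 : Type*) [RCLike 𝕜] {𝔤 : Type*} [LieRing 𝔤] [LieAlgebra 𝕜 𝔤]

/-- The flip `∑ xᵢ ⊗ yᵢ ↦ ∑ yᵢ ⊗ xᵢ`, written `r ↦ r²¹`. -/
def flip {V : Type*} [AddCommGroup V] [Module 𝕜 V] : V ⊗[𝕜] V →ₗ[𝕜] V ⊗[𝕜] V :=
  (TensorProduct.comm 𝕜 V V).toLinearMap

/-- The linear map `V ⊗ V → W ⊗ W` induced by a linear map `V → W`. -/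
def sq {V W : Type*} [AddCommGroup V] [Module 𝕜 V] [AddCommGroup W] [Module 𝕜 W]
    (f : V →ₗ[𝕜] W) : V ⊗[𝕜] V →ₗ[𝕜] W ⊗[𝕜] W :=
  TensorProduct.map f f

/-- The symmetric part of a 2-tensor. -/
def symmPart (r : 𝔤 ⊗[𝕜] 𝔤) : 𝔤 ⊗[𝕜] 𝔤 := (2 : 𝕜)⁻¹ • (r + flip 𝕜 r)

/-- The Lie bracket as a linear map `𝔤 ⊗ 𝔤 → 𝔤`. -/
def bracketMap : 𝔤 ⊗[𝕜] 𝔤 →ₗ[𝕜] 𝔤 :=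
  (LieModule.toModuleHom 𝕜 𝔤 𝔤 : 𝔤 ⊗[𝕜] 𝔤 →ₗ[𝕜] 𝔤)

/-- `[r₁₂, r'₁₃] + [r₁₂, r'₂₃] + [r₁₃, r'₂₃]` as an element of `𝔤 ⊗ 𝔤 ⊗ 𝔤`; see `cyb₂_tmul` for
its value on pure tensors. -/
def cyb₂ (r r' : 𝔤 ⊗[𝕜] 𝔤) : 𝔤 ⊗[𝕜] (𝔤 ⊗[𝕜] 𝔤) :=
  let c := TensorProduct.tensorTensorTensorComm 𝕜 𝔤 𝔤 𝔤 𝔤 (r ⊗ₜ[𝕜] r')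
  TensorProduct.map (bracketMap 𝕜) LinearMap.id c
    + TensorProduct.map LinearMap.id
        (TensorProduct.map (bracketMap 𝕜) LinearMap.id ∘ₗ
          (TensorProduct.assoc 𝕜 𝔤 𝔤 𝔤).symm.toLinearMap)
        (TensorProduct.assoc 𝕜 𝔤 𝔤 (𝔤 ⊗[𝕜] 𝔤) (r ⊗ₜ[𝕜] r'))
    + TensorProduct.assoc 𝕜 𝔤 𝔤 𝔤 (TensorProduct.map LinearMap.id (bracketMap 𝕜) c)

theorem cyb₂_tmul (x y x' y' : 𝔤) :
    cyb₂ 𝕜 (x ⊗ₜ[𝕜] y) (x' ⊗ₜ[𝕜] y') =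
      ⁅x, x'⁆ ⊗ₜ[𝕜] (y ⊗ₜ[𝕜] y') + x ⊗ₜ[𝕜] (⁅y, x'⁆ ⊗ₜ[𝕜] y')
        + x ⊗ₜ[𝕜] (x' ⊗ₜ[𝕜] ⁅y, y'⁆) := by
  simp [cyb₂, bracketMap]

/-- The classical Yang-Baxter operator. -/
def CYB (r : 𝔤 ⊗[𝕜] 𝔤) : 𝔤 ⊗[𝕜] (𝔤 ⊗[𝕜] 𝔤) := cyb₂ 𝕜 r r

/-- `r` is a quasitriangular `r`-matrix on `𝔤`: its symmetric part is `ad`-invariant and it solves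
the classical Yang-Baxter equation. -/
structure IsQuasitriangular (r : 𝔤 ⊗[𝕜] 𝔤) : Prop where
  symm_invariant : ∀ x : 𝔤, ⁅x, symmPart 𝕜 r⁆ = 0
  cyb_eq_zero : CYB 𝕜 r = 0

/-- The cobracket `δ_r(x) = ad_x r`. -/
def cobracket (r : 𝔤 ⊗[𝕜] 𝔤) (x : 𝔤) : 𝔤 ⊗[𝕜] 𝔤 := ⁅x, r⁆

variable {n : ℕ}

/-- The inclusion `x ↦ (x)_j` of `𝔤` into `𝔤ⁿ` as the `j`-th summand. -/
def incl (j : Fin n) : 𝔤 →ₗ[𝕜] (Fin n → 𝔤) := LinearMap.single 𝕜 (fun _ => 𝔤) j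

/-- `Altⁿ(r) = (r, -r²¹, r, -r²¹, …)`. The indices start at `0` here, so the entries `r` are those
with even index. -/
def Alt (n : ℕ) (r : 𝔤 ⊗[𝕜] 𝔤) : (Fin n → 𝔤) ⊗[𝕜] (Fin n → 𝔤) :=
  ∑ j : Fin n, sq 𝕜 (incl 𝕜 j) (if Even (j : ℕ) then r else -flip 𝕜 r)

/-- `Mixⁿ(r)_{j,k} = ∑ᵢ (yᵢ)_j ∧ (xᵢ)_k` for `r = ∑ᵢ xᵢ ⊗ yᵢ`, where `u ∧ v = u ⊗ v - v ⊗ u`. -/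
def MixPair (j k : Fin n) (r : 𝔤 ⊗[𝕜] 𝔤) : (Fin n → 𝔤) ⊗[𝕜] (Fin n → 𝔤) :=
  TensorProduct.map (incl 𝕜 j) (incl 𝕜 k) (flip 𝕜 r)
    - TensorProduct.map (incl 𝕜 k) (incl 𝕜 j) r

theorem MixPair_tmul (j k : Fin n) (x y : 𝔤) :
    MixPair 𝕜 j k (x ⊗ₜ[𝕜] y) =
      incl 𝕜 j y ⊗ₜ[𝕜] incl 𝕜 k x - incl 𝕜 k x ⊗ₜ[𝕜] incl 𝕜 j y := by
  simp [MixPair, flip]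

/-- `Mixⁿ(r) = ∑_{j < k} Mixⁿ(r)_{j,k}`. -/
def Mix (n : ℕ) (r : 𝔤 ⊗[𝕜] 𝔤) : (Fin n → 𝔤) ⊗[𝕜] (Fin n → 𝔤) :=
  ∑ j : Fin n, ∑ k : Fin n, if j < k then MixPair 𝕜 j k r else 0

/-- `r⁽ⁿ⁾ = Altⁿ(r) - Mixⁿ(r)`. -/
def rPow (n : ℕ) (r : 𝔤 ⊗[𝕜] 𝔤) : (Fin n → 𝔤) ⊗[𝕜] (Fin n → 𝔤) := Alt 𝕜 n r - Mix 𝕜 n r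

/-- The diagonal embedding `𝔤 → 𝔤ⁿ`. -/
def diag (n : ℕ) : 𝔤 →ₗ[𝕜] (Fin n → 𝔤) := LinearMap.pi fun _ => LinearMap.id

end RMatrix

/-! ## Vector fields, 2-tensor fields, Schouten brackets, Poisson spaces

Everything is over `𝕜 = ℝ` or `ℂ`; `C^∞` over `ℂ` means holomorphic. -/

section Manifold

variable {𝕜 : Type*} [RCLike 𝕜] {E : Type*} [NormedAddCommGroup E] [NormedSpace 𝕜 E]
  {H : Type*} [TopologicalSpace H] (I : ModelWithCorners 𝕜 E H)
  (M : Type*) [TopologicalSpace M] [ChartedSpace H M]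

/-- Not necessarily smooth vector fields on `M`. -/
abbrev VField : Type _ := ∀ y : M, TangentSpace I y

/-- Not necessarily smooth contravariant 2-tensor fields on `M`, i.e. sections of `TM ⊗ TM`. -/
abbrev TField₂ : Type _ := ∀ y : M, TangentSpace I y ⊗[𝕜] TangentSpace I y

variable {M}

/-- The value `t(α, β)` of a 2-tensor on two covectors, `(u ⊗ v)(α, β) = α(u) β(v)`. -/
def pair {y : M} (t : TangentSpace I y ⊗[𝕜] TangentSpace I y)
    (α β : TangentSpace I y →L[𝕜] 𝕜) : 𝕜 :=
  TensorProduct.lid 𝕜 𝕜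
    (TensorProduct.map (α : TangentSpace I y →ₗ[𝕜] 𝕜) (β : TangentSpace I y →ₗ[𝕜] 𝕜) t)

/-- The function `X(f) = df(X)`. -/
def deriv₁ (X : VField I M) (f : M → 𝕜) : M → 𝕜 := fun y => mvfderiv I f y (X y)

/-- The function `π(df, dg)`. -/
def deriv₂ (π : TField₂ I M) (f g : M → 𝕜) : M → 𝕜 :=
  fun y => pair I (π y) (mvfderiv I f y) (mvfderiv I g y)

/-- For a covector `α` at `y`, the function on the domain of the preferred chart at `y` which is
linear in that chart and has differential `α` at `y` (by definition `T_y M` is the model space `E`,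
through the derivative of that chart at `y`). -/
def linFun (y : M) (α : TangentSpace I y →L[𝕜] 𝕜) : M → 𝕜 :=
  fun z => α (extChartAt I y z)

/-- The Schouten bracket `[X, π]` (the Lie derivative of `π` along `X`) of a vector field and a
2-tensor field, as a bilinear form on covectors at `y`. It is the tensor given by
`[X, π](df, dg) = X(π(df, dg)) - π(d(X f), dg) - π(df, d(X g))`,
evaluated on functions `f`, `g` with `df = α`, `dg = β` at `y`. -/
def schouten₁₂ (X : VField I M) (π : TField₂ I M) (y : M) (α β : TangentSpace I y →L[𝕜] 𝕜) : 𝕜 :=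
  let f := linFun I y α
  let g := linFun I y β
  deriv₁ I X (deriv₂ I π f g) y - deriv₂ I π (deriv₁ I X f) g y - deriv₂ I π f (deriv₁ I X g) y

/-- The Schouten bracket `[π, ρ]` of two bivector fields, as a trilinear form on covectors at `y`.
It is the trivector given by
`[π, ρ](df, dg, dh) = ∑_cyc (π(df, d(ρ(dg, dh))) + ρ(df, d(π(dg, dh))))`,
evaluated on functions `f`, `g`, `h` with `df = α`, `dg = β`, `dh = γ` at `y`.
So `[π, π](df, dg, dh)` is twice the Jacobiator of `{f, g} = π(df, dg)`. -/
def schouten₂₂ (π ρ : TField₂ I M) (y : M) (α β γ : TangentSpace I y →L[𝕜] 𝕜) : 𝕜 :=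
  let f := linFun I y α
  let g := linFun I y β
  let h := linFun I y γ
  (deriv₂ I π f (deriv₂ I ρ g h) y + deriv₂ I ρ f (deriv₂ I π g h) y)
    + (deriv₂ I π g (deriv₂ I ρ h f) y + deriv₂ I ρ g (deriv₂ I π h f) y)
    + (deriv₂ I π h (deriv₂ I ρ f g) y + deriv₂ I ρ h (deriv₂ I π f g) y)

/-- `π` is a (smooth or holomorphic) bivector field: a skew-symmetric 2-tensor field whose
coefficients in charts are `C^∞`. -/
structure IsBivector (π : TField₂ I M) : Prop where
  skew : ∀ y, flip 𝕜 (π y) = -π y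
  smooth : ∀ (y : M) (α β : TangentSpace I y →L[𝕜] 𝕜),
    ContMDiffOn I 𝓘(𝕜, 𝕜) ∞ (deriv₂ I π (linFun I y α) (linFun I y β)) (chartAt H y).source

/-- `π` is a Poisson structure: a bivector field with `[π, π] = 0`. -/
structure IsPoisson (π : TField₂ I M) : Prop extends IsBivector I π where
  schouten_eq_zero : ∀ y, schouten₂₂ I π π y = 0

variable {𝔤 : Type*} [LieRing 𝔤] [LieAlgebra 𝕜 𝔤]

/-- A left action of `𝔤` on `M`: a Lie algebra anti-homomorphism from `𝔤` to the smooth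
(holomorphic) vector fields on `M`. -/
structure IsLeftAction [IsManifold I ∞ M] (lam : 𝔤 →ₗ[𝕜] VField I M) : Prop where
  smooth : ∀ x, ContMDiff I I.tangent ∞ (fun y => (⟨y, lam x y⟩ : TangentBundle I M))
  anti : ∀ x x', lam ⁅x, x'⁆ = -VectorField.mlieBracket I (lam x) (lam x')

variable {I}

/-- The 2-tensor field `σ(r) = ∑ᵢ σ(xᵢ) ⊗ σ(yᵢ)` for `r = ∑ᵢ xᵢ ⊗ yᵢ`. -/
def actTensor (σ : 𝔤 →ₗ[𝕜] VField I M) (r : 𝔤 ⊗[𝕜] 𝔤) : TField₂ I M :=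
  fun y => sq 𝕜 (LinearMap.proj y ∘ₗ σ) r

variable (I)

/-- `(M, π, lam)` is a left `(𝔤, r)`-Poisson space: `r` is a quasitriangular `r`-matrix, `π` is a
Poisson structure on `M`, and `lam` is a left action of `𝔤` on `M` with
`[lam(x), π] = lam(δ_r(x))` for all `x`. -/
structure IsLeftPoissonSpace [IsManifold I ∞ M] (r : 𝔤 ⊗[𝕜] 𝔤) (π : TField₂ I M)
    (lam : 𝔤 →ₗ[𝕜] VField I M) : Prop where
  quasitriangular : IsQuasitriangular 𝕜 r
  poisson : IsPoisson I π
  action : IsLeftAction I lam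
  compat : ∀ (x : 𝔤) (y : M),
    schouten₁₂ I (lam x) π y = pair I (actTensor lam (cobracket 𝕜 r x) y)

end Manifold

/-! ## Product manifolds -/

section Product

variable {𝕜 : Type*} [RCLike 𝕜] {n : ℕ}
  {E : Fin n → Type*} [∀ j, NormedAddCommGroup (E j)] [∀ j, NormedSpace 𝕜 (E j)]
  {H : Fin n → Type*} [∀ j, TopologicalSpace (H j)] {I : ∀ j, ModelWithCorners 𝕜 (E j) (H j)}
  {Y : Fin n → Type*} [∀ j, TopologicalSpace (Y j)] [∀ j, ChartedSpace (H j) (Y j)]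
  {𝔤 : Type*} [LieRing 𝔤] [LieAlgebra 𝕜 𝔤]

/-- The inclusion of `T_{y_j} Y_j` as the `j`-th summand of `T_y (∏ Y_j) = ⨁ T_{y_j} Y_j`. -/
def tangentIncl (y : ∀ j, Y j) (j : Fin n) :
    TangentSpace (I j) (y j) →ₗ[𝕜] TangentSpace (ModelWithCorners.pi I) y :=
  LinearMap.single 𝕜 E j

/-- The direct product `(π_1, …, π_n)` of 2-tensor fields. -/
def prodTensor (π : ∀ j, TField₂ (I j) (Y j)) : TField₂ (ModelWithCorners.pi I) (∀ j, Y j) :=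
  fun y => ∑ j, sq 𝕜 (tangentIncl y j) (π j (y j))

/-- The direct product action `lam(x_1, …, x_n) = (lam_1(x_1), …, lam_n(x_n))` of `𝔤ⁿ`. -/
def prodAction (lam : ∀ j, 𝔤 →ₗ[𝕜] VField (I j) (Y j)) :
    (Fin n → 𝔤) →ₗ[𝕜] VField (ModelWithCorners.pi I) (∀ j, Y j) :=
  LinearMap.pi fun y =>
    ∑ j, tangentIncl y j ∘ₗ LinearMap.proj (y j) ∘ₗ lam j ∘ₗ LinearMap.proj j

/-- `π_Y = (π_1, …, π_n) + lam(Mixⁿ(r))`. -/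
def fusionTensor (r : 𝔤 ⊗[𝕜] 𝔤) (π : ∀ j, TField₂ (I j) (Y j))
    (lam : ∀ j, 𝔤 →ₗ[𝕜] VField (I j) (Y j)) :
    TField₂ (ModelWithCorners.pi I) (∀ j, Y j) :=
  prodTensor π + actTensor (prodAction lam) (Mix 𝕜 n r)

end Product

end PoissonFusion

end

noncomputable section

namespace PoissonFusion

/-! ### Calculus in the preferred chart: linear functions, smoothness, Lie brackets -/

section Calculus

open Set Filter Topology VectorField

variable {𝕜 : Type*} [RCLike 𝕜] {E : Type*} [NormedAddCommGroup E] [NormedSpace 𝕜 E]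
  {H : Type*} [TopologicalSpace H] {I : ModelWithCorners 𝕜 E H}
  {M : Type*} [TopologicalSpace M] [ChartedSpace H M]

/-! Everything is checked block by block. A covector on the product is a sum of covectors pulled
back from the factors (`exists_eq_sum_tangentProj`), and the Schouten brackets are additive in their
covectors, so only pulled back covectors have to be tested.

Write `R j k` for `rComp 𝕜 r j k`, which is always `r` or `-r²¹`. Then `r⁽ⁿ⁾` is the sum of the
blocks `(R j k)` in positions `j, k` (`rPow_eq_sum`), while `π_Y` has diagonal blocks `π j` and
off-diagonal blocks `-(lam j ⊗ lam k)(R j k)`.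

The algebraic core is a mixed Yang-Baxter equation, `IsQuasitriangular.cyb₃_rComp`: for all `j, k,
l`, `[(R j k)₁₂, (R j l)₁₃] + [(R j k)₁₂, (R k l)₂₃] + [(R j l)₁₃, (R k l)₂₃] = 0`. It holds because
`r` and `-r²¹` differ by the invariant tensor `r + r²¹`, which allows one to be exchanged for the
other one slot at a time. The two patterns that this does not reach are excluded by the order of the
indices.

These equations are the blocks of the Yang-Baxter equation for `r⁽ⁿ⁾`. They also give the Jacobi
identity of `π_Y`. On three distinct factors the Jacobiator is minus the image of the left hand side
under the actions. On factors `j, j, l` the same is true once the derivative of `π j` along `lam j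
x` is replaced by means of the compatibility condition. On a single factor it is the Jacobiator of
`π j`.

Compatibility with the action of `𝔤ⁿ` follows from the Leibniz rule and the anti-homomorphism
property. For the diagonal action, every block satisfies `ad_x (R j k) = ad_x r`, so `ad_x r⁽ⁿ⁾` is
the diagonal image of `ad_x r`. In the last claim, skewness of `π j = -lam j (r)` makes `r` and
`-r²¹` act in the same way, so the alternation in `Altⁿ` is invisible. -/

theorem mvfderiv_congr {f g : M → 𝕜} {y : M} (h : f =ᶠ[𝓝 y] g) :
    mvfderiv I f y = mvfderiv I g y := by
  have := h.mfderiv_eq (I := I) (I' := 𝓘(𝕜, 𝕜))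
  exact this

theorem mdifferentiableAt_sum {ι : Type*} (s : Finset ι) {f : ι → M → 𝕜} {y : M}
    (h : ∀ i ∈ s, MDifferentiableAt I 𝓘(𝕜, 𝕜) (f i) y) :
    MDifferentiableAt I 𝓘(𝕜, 𝕜) (fun z => ∑ i ∈ s, f i z) y := by
  classical
  induction s using Finset.induction_on with
  | empty => simpa using! mdifferentiableAt_const (I := I) (c := (0 : 𝕜)) (x := y)
  | insert a s ha ih =>
    simp only [Finset.sum_insert ha]
    exact (h a (Finset.mem_insert_self a s)).add
      (ih fun i hi => h i (Finset.mem_insert_of_mem hi))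

theorem mvfderiv_sum {ι : Type*} (s : Finset ι) {f : ι → M → 𝕜} {y : M}
    (h : ∀ i ∈ s, MDifferentiableAt I 𝓘(𝕜, 𝕜) (f i) y) :
    mvfderiv I (fun z => ∑ i ∈ s, f i z) y = ∑ i ∈ s, mvfderiv I (f i) y := by
  classical
  induction s using Finset.induction_on with
  | empty => simpa using! mvfderiv_const (I := I) (0 : 𝕜) (x := y)
  | insert a s ha ih =>
    have hs : ∀ i ∈ s, MDifferentiableAt I 𝓘(𝕜, 𝕜) (f i) y :=
      fun i hi => h i (Finset.mem_insert_of_mem hi)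
    simp only [Finset.sum_insert ha]
    rw [← ih hs]
    exact mvfderiv_fun_add (h a (Finset.mem_insert_self a s)) (mdifferentiableAt_sum s hs)

/-- The differential at `z` of the preferred chart at `y`, with values in `T_y M`. -/
def chartDeriv (I : ModelWithCorners 𝕜 E H) (y z : M) : TangentSpace I z →L[𝕜] TangentSpace I y :=
  mfderiv I 𝓘(𝕜, E) (extChartAt I y) z

section
variable [IsManifold I 1 M]

theorem mdifferentiableAt_linFun {y z : M} (hz : z ∈ (chartAt H y).source)
    (α : TangentSpace I y →L[𝕜] 𝕜) : MDifferentiableAt I 𝓘(𝕜, 𝕜) (linFun I y α) z := by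
  let a : E →L[𝕜] 𝕜 := α
  exact (a.mdifferentiableAt (x := extChartAt I y z)).comp z (mdifferentiableAt_extChartAt hz)

theorem mvfderiv_linFun {y z : M} (hz : z ∈ (chartAt H y).source)
    (α : TangentSpace I y →L[𝕜] 𝕜) : mvfderiv I (linFun I y α) z = α ∘L chartDeriv I y z := by
  let a : E →L[𝕜] 𝕜 := α
  have h := mfderiv_comp z (a.mdifferentiableAt (x := extChartAt I y z))
    (mdifferentiableAt_extChartAt (I := I) hz)
  rw [ContinuousLinearMap.mfderiv_eq] at h
  exact h

theorem chartDeriv_self (y : M) : chartDeriv I y y = ContinuousLinearMap.id 𝕜 _ :=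
  mfderiv_extChartAt_self

theorem mvfderiv_linFun_self (y : M) (α : TangentSpace I y →L[𝕜] 𝕜) :
    mvfderiv I (linFun I y α) y = α := by
  rw [mvfderiv_linFun (mem_chart_source H y), chartDeriv_self]
  rfl

theorem deriv₁_linFun {y z : M} (hz : z ∈ (chartAt H y).source)
    (α : TangentSpace I y →L[𝕜] 𝕜) (X : VField I M) :
    deriv₁ I X (linFun I y α) z = α (chartDeriv I y z (X z)) := by
  rw [deriv₁, mvfderiv_linFun hz]
  rfl

theorem deriv₁_linFun_self (y : M) (α : TangentSpace I y →L[𝕜] 𝕜) (X : VField I M) :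
    deriv₁ I X (linFun I y α) y = α (X y) := by
  rw [deriv₁, mvfderiv_linFun_self]

/-- This links coordinates of a vector field tested on the functions `linFun` with the bundle
coordinates in which smoothness of a section is expressed. -/
theorem chartDeriv_eq_trivializationAt {y z : M} (hz : z ∈ (chartAt H y).source)
    (v : TangentSpace I z) :
    chartDeriv I y z v = (trivializationAt E (TangentSpace I) y ⟨z, v⟩).2 := by
  have h := DFunLike.congr_fun (TangentBundle.continuousLinearMapAt_trivializationAt (I := I) hz) v
  refine h.symm.trans ?_
  rw [Bundle.Trivialization.continuousLinearMapAt_apply,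
    Bundle.Trivialization.coe_linearMapAt_of_mem _ (by exact hz)]

end

section
variable [IsManifold I ∞ M]

theorem contMDiffOn_deriv₁_linFun {X : VField I M}
    (hX : ContMDiff I I.tangent ∞ (fun y => (⟨y, X y⟩ : TangentBundle I M))) (y : M)
    (α : TangentSpace I y →L[𝕜] 𝕜) :
    ContMDiffOn I 𝓘(𝕜, 𝕜) ∞ (deriv₁ I X (linFun I y α)) (chartAt H y).source := by
  let a : E →L[𝕜] 𝕜 := α
  have h := (Bundle.Trivialization.contMDiffOn_section_baseSet_iff
    (trivializationAt E (TangentSpace I) y)).1 (hX.contMDiffOn (s := (chartAt H y).source))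
  refine (a.contMDiff.comp_contMDiffOn h).congr fun z hz => ?_
  rw [deriv₁_linFun hz, chartDeriv_eq_trivializationAt hz]
  rfl

/-- In finite dimension a coordinate vector is smooth as soon as its finitely many scalar
coordinates are, and each of these is a derivative of some `linFun`. -/
theorem contMDiff_vectorField_of_deriv₁_linFun [FiniteDimensional 𝕜 E] {X : VField I M}
    (h : ∀ (y : M) (α : TangentSpace I y →L[𝕜] 𝕜),
      ContMDiffAt I 𝓘(𝕜, 𝕜) ∞ (deriv₁ I X (linFun I y α)) y) :
    ContMDiff I I.tangent ∞ (fun y => (⟨y, X y⟩ : TangentBundle I M)) := by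
  intro y
  refine (Bundle.contMDiffAt_section y).2 ?_
  let e : E ≃L[𝕜] (Fin (Module.finrank 𝕜 E) → 𝕜) := ContinuousLinearEquiv.ofFinrankEq (by simp)
  have key : ContMDiffAt I 𝓘(𝕜, Fin (Module.finrank 𝕜 E) → 𝕜) ∞
      (fun z => e (trivializationAt E (TangentSpace I) y ⟨z, X z⟩).2) y := by
    refine contMDiffAt_pi_space.2 fun i => ?_
    let a : E →L[𝕜] 𝕜 := ContinuousLinearMap.proj i ∘L e.toContinuousLinearMap
    refine (h y a).congr_of_eventuallyEq ?_
    filter_upwards [(chartAt H y).open_source.mem_nhds (mem_chart_source H y)] with z hz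
    have := deriv₁_linFun (I := I) hz a X
    rw [chartDeriv_eq_trivializationAt hz] at this
    exact this.symm
  have := (e.symm.contDiff (n := ∞)).contMDiff.contMDiffAt.comp y key
  refine this.congr_of_eventuallyEq (Eventually.of_forall fun z => ?_)
  simp

/-- In the chart at `y` the bracket is `DX'(X) - DX(X')`. Since `linFun I y α` is linear there,
applying `α` to each term gives an iterated derivative of that function. -/
theorem deriv₁_mlieBracket [CompleteSpace E] {X X' : VField I M}
    (hX : ContMDiff I I.tangent ∞ (fun y => (⟨y, X y⟩ : TangentBundle I M)))
    (hX' : ContMDiff I I.tangent ∞ (fun y => (⟨y, X' y⟩ : TangentBundle I M)))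
    (y : M) (α : TangentSpace I y →L[𝕜] 𝕜) :
    α (mlieBracket I X X' y) = deriv₁ I X (deriv₁ I X' (linFun I y α)) y
      - deriv₁ I X' (deriv₁ I X (linFun I y α)) y := by
  let a : E →L[𝕜] 𝕜 := α
  have hs := (chartAt H y).open_source.mem_nhds (mem_chart_source H y)
  have hpull : ∀ (W : VField I M), ∀ u ∈ (extChartAt I y).target,
      (mpullbackWithin 𝓘(𝕜, E) I (extChartAt I y).symm W (range I) u : E) =
        chartDeriv I y ((extChartAt I y).symm u) (W ((extChartAt I y).symm u)) := by
    intro W u hu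
    rw [mpullbackWithin_apply, ContinuousLinearMap.inverse_eq
      (mfderivWithin_extChartAt_symm_comp_mfderiv_extChartAt hu)
      (mfderiv_extChartAt_comp_mfderivWithin_extChartAt_symm hu)]
    rfl
  have hpt : ∀ W : VField I M, mpullbackWithin 𝓘(𝕜, E) I (extChartAt I y).symm W (range I)
      (extChartAt I y y) = W y := by
    intro W
    -- The point is kept as a variable `z` because the type of `W z` depends on it and `(extChartAt
    -- I y).symm (extChartAt I y y)` equals `y` only propositionally.
    have : ∀ z, z = y → (chartDeriv I y z (W z) : E) = W y := by
      rintro _ rfl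
      rw [chartDeriv_self]
      rfl
    exact (hpull W _ (mem_extChartAt_target y)).trans (this _ (extChartAt_to_inv y))
  -- Each half of the bracket is treated separately: read in the chart, `deriv₁ I W (linFun I y α)`
  -- is `a` composed with the coordinate expression of `W`.
  have main : ∀ {V W : VField I M},
      ContMDiff I I.tangent ∞ (fun y => (⟨y, W y⟩ : TangentBundle I M)) →
      a (fderivWithin 𝕜 (mpullbackWithin 𝓘(𝕜, E) I (extChartAt I y).symm W (range I)) (range I)
        (extChartAt I y y) (V y)) = deriv₁ I V (deriv₁ I W (linFun I y α)) y := by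
    intro V W hW
    have hd := ((contMDiffOn_deriv₁_linFun hW y α).contMDiffAt hs).mdifferentiableAt (by simp)
    have hW' := MDifferentiableWithinAt.differentiableWithinAt_mpullbackWithin_vectorField
      (s := univ) (hW.mdifferentiable (by simp) y).mdifferentiableWithinAt
    rw [preimage_univ, univ_inter] at hW'
    rw [deriv₁, hd.mvfderiv]
    have hu := I.uniqueDiffOn.uniqueDiffWithinAt (mem_range_self (chartAt H y y))
    have h1 := (a.hasFDerivAt.comp_hasFDerivWithinAt _ hW'.hasFDerivWithinAt).fderivWithin hu
    have h2 : writtenInExtChartAt I 𝓘(𝕜, 𝕜) y (deriv₁ I W (linFun I y α)) =ᶠ[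
        𝓝[range I] (extChartAt I y y)]
        a ∘ mpullbackWithin 𝓘(𝕜, E) I (extChartAt I y).symm W (range I) := by
      filter_upwards [extChartAt_target_mem_nhdsWithin (I := I) y] with u hu
      have hu' : (extChartAt I y).symm u ∈ (chartAt H y).source := by
        rw [← extChartAt_source I]; exact (extChartAt I y).map_target hu
      exact (deriv₁_linFun hu' α W).trans (congrArg a (hpull W u hu)).symm
    rw [h2.fderivWithin_eq_of_mem (mem_range_self _), h1]
    rfl
  have hbr : (mlieBracket I X X' y : E) = lieBracketWithin 𝕜
      (mpullbackWithin 𝓘(𝕜, E) I (extChartAt I y).symm X (range I))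
      (mpullbackWithin 𝓘(𝕜, E) I (extChartAt I y).symm X' (range I)) (range I)
      (extChartAt I y y) := by
    rw [← mlieBracketWithin_univ, mlieBracketWithin_apply, mfderiv_extChartAt_self,
      preimage_univ, univ_inter]
    exact DFunLike.congr_fun (ContinuousLinearMap.inverse_id (R := 𝕜) (M := E)) _
  refine (congrArg a hbr).trans ?_
  refine (map_sub a _ _).trans (congrArg₂ _ ?_ ?_)
  · exact (congrArg (fun v => a (fderivWithin 𝕜 _ _ _ v)) (hpt X)).trans (main hX')
  · exact (congrArg (fun v => a (fderivWithin 𝕜 _ _ _ v)) (hpt X')).trans (main hX)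

end

end Calculus

/-! ### Evaluating 2-tensors on pairs of linear forms -/

section Evaluation

variable {𝕜 : Type*} [RCLike 𝕜] {V W : Type*} [AddCommGroup V] [Module 𝕜 V]
  [AddCommGroup W] [Module 𝕜 W]

/-- The functional `u ⊗ v ↦ φ u * ψ v` on `V ⊗ V`. -/
def ev (φ ψ : V →ₗ[𝕜] 𝕜) : V ⊗[𝕜] V →ₗ[𝕜] 𝕜 :=
  (TensorProduct.lid 𝕜 𝕜).toLinearMap ∘ₗ TensorProduct.map φ ψ

@[simp]
theorem ev_tmul (φ ψ : V →ₗ[𝕜] 𝕜) (u v : V) : ev φ ψ (u ⊗ₜ[𝕜] v) = φ u * ψ v := by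
  simp [ev]

theorem ev_add_left (φ φ' ψ : V →ₗ[𝕜] 𝕜) : ev (φ + φ') ψ = ev φ ψ + ev φ' ψ := by
  ext u v; simp [add_mul]

theorem ev_add_right (φ ψ ψ' : V →ₗ[𝕜] 𝕜) : ev φ (ψ + ψ') = ev φ ψ + ev φ ψ' := by
  ext u v; simp [mul_add]

theorem ev_smul_left (c : 𝕜) (φ ψ : V →ₗ[𝕜] 𝕜) : ev (c • φ) ψ = c • ev φ ψ := by
  ext u v; simp [mul_assoc]

theorem ev_smul_right (c : 𝕜) (φ ψ : V →ₗ[𝕜] 𝕜) : ev φ (c • ψ) = c • ev φ ψ := by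
  ext u v; simp [mul_left_comm]

@[simp]
theorem ev_zero_left (ψ : V →ₗ[𝕜] 𝕜) : ev 0 ψ = 0 := by
  ext u v; simp

@[simp]
theorem ev_zero_right (φ : V →ₗ[𝕜] 𝕜) : ev φ 0 = 0 := by
  ext u v; simp

theorem ev_map (φ ψ : W →ₗ[𝕜] 𝕜) (f g : V →ₗ[𝕜] W) (t : V ⊗[𝕜] V) :
    ev φ ψ (TensorProduct.map f g t) = ev (φ ∘ₗ f) (ψ ∘ₗ g) t := by
  have : ev φ ψ ∘ₗ TensorProduct.map f g = ev (φ ∘ₗ f) (ψ ∘ₗ g) := by ext u v; simp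
  exact DFunLike.congr_fun this t

theorem ev_sq (φ ψ : W →ₗ[𝕜] 𝕜) (f : V →ₗ[𝕜] W) (t : V ⊗[𝕜] V) :
    ev φ ψ (sq 𝕜 f t) = ev (φ ∘ₗ f) (ψ ∘ₗ f) t :=
  ev_map φ ψ f f t

theorem ev_flip (φ ψ : V →ₗ[𝕜] 𝕜) (t : V ⊗[𝕜] V) : ev φ ψ (flip 𝕜 t) = ev ψ φ t := by
  have : ev φ ψ ∘ₗ flip 𝕜 = ev ψ φ := by ext u v; simp [flip, mul_comm]
  exact DFunLike.congr_fun this t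

theorem exists_eq_sum_tmul (t : V ⊗[𝕜] V) :
    ∃ S : Finset (V × V), t = ∑ i ∈ S, i.1 ⊗ₜ[𝕜] i.2 :=
  TensorProduct.exists_finset t

end Evaluation

/-! ### Additivity and symmetry of the Schouten brackets in their covectors -/

section Schouten

open Set Filter Topology VectorField

variable {𝕜 : Type*} [RCLike 𝕜] {E : Type*} [NormedAddCommGroup E] [NormedSpace 𝕜 E]
  {H : Type*} [TopologicalSpace H] {I : ModelWithCorners 𝕜 E H}
  {M : Type*} [TopologicalSpace M] [ChartedSpace H M]

theorem pair_eq_ev {y : M} (t : TangentSpace I y ⊗[𝕜] TangentSpace I y)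
    (α β : TangentSpace I y →L[𝕜] 𝕜) : pair I t α β = ev (α : TangentSpace I y →ₗ[𝕜] 𝕜) β t :=
  rfl

/-- The bilinear form on covectors defined by a 2-tensor. -/
def pairₗ {y : M} (t : TangentSpace I y ⊗[𝕜] TangentSpace I y) :
    (TangentSpace I y →L[𝕜] 𝕜) →ₗ[𝕜] (TangentSpace I y →L[𝕜] 𝕜) →ₗ[𝕜] 𝕜 :=
  LinearMap.mk₂ 𝕜 (pair I t)
    (fun α α' β => DFunLike.congr_fun (ev_add_left (α : TangentSpace I y →ₗ[𝕜] 𝕜) α' β) t)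
    (fun c α β => DFunLike.congr_fun (ev_smul_left c (α : TangentSpace I y →ₗ[𝕜] 𝕜) β) t)
    (fun α β β' => DFunLike.congr_fun (ev_add_right (α : TangentSpace I y →ₗ[𝕜] 𝕜) β β') t)
    (fun c α β => DFunLike.congr_fun (ev_smul_right c (α : TangentSpace I y →ₗ[𝕜] 𝕜) β) t)

theorem pairₗ_apply {y : M} (t : TangentSpace I y ⊗[𝕜] TangentSpace I y)
    (α β : TangentSpace I y →L[𝕜] 𝕜) : pairₗ t α β = pair I t α β :=
  rfl

theorem pair_skew {y : M} {t : TangentSpace I y ⊗[𝕜] TangentSpace I y} (ht : flip 𝕜 t = -t)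
    (α β : TangentSpace I y →L[𝕜] 𝕜) : pair I t α β = -pair I t β α := by
  rw [pair_eq_ev, pair_eq_ev, ← ev_flip, ht, map_neg]

theorem deriv₂_eq (π : TField₂ I M) (f g : M → 𝕜) (y : M) :
    deriv₂ I π f g y = pairₗ (π y) (mvfderiv I f y) (mvfderiv I g y) :=
  rfl

theorem deriv₂_skew {π : TField₂ I M} (hπ : ∀ y, flip 𝕜 (π y) = -π y) (f g : M → 𝕜) :
    deriv₂ I π f g = -deriv₂ I π g f :=
  funext fun y => pair_skew (hπ y) _ _

section
variable [IsManifold I ∞ M]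

omit [IsManifold I ∞ M] in
theorem mdifferentiableAt_deriv₂_linFun {π : TField₂ I M} (hπ : IsBivector I π) (y : M)
    (α β : TangentSpace I y →L[𝕜] 𝕜) :
    MDifferentiableAt I 𝓘(𝕜, 𝕜) (deriv₂ I π (linFun I y α) (linFun I y β)) y :=
  ((hπ.smooth y α β).contMDiffAt
    ((chartAt H y).open_source.mem_nhds (mem_chart_source H y))).mdifferentiableAt (by simp)

theorem mdifferentiableAt_deriv₁_linFun {X : VField I M}
    (hX : ContMDiff I I.tangent ∞ (fun y => (⟨y, X y⟩ : TangentBundle I M))) (y : M)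
    (α : TangentSpace I y →L[𝕜] 𝕜) :
    MDifferentiableAt I 𝓘(𝕜, 𝕜) (deriv₁ I X (linFun I y α)) y :=
  ((contMDiffOn_deriv₁_linFun hX y α).contMDiffAt
    ((chartAt H y).open_source.mem_nhds (mem_chart_source H y))).mdifferentiableAt (by simp)

/-- The differential of `linFun` is computed through the chart derivative only on the chart source,
hence a local equality; this suffices for taking differentials at `y`. -/
theorem deriv₁_linFun_add_eventuallyEq (X : VField I M) (y : M)
    (α α' : TangentSpace I y →L[𝕜] 𝕜) :
    deriv₁ I X (linFun I y (α + α')) =ᶠ[𝓝 y]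
      deriv₁ I X (linFun I y α) + deriv₁ I X (linFun I y α') := by
  filter_upwards [(chartAt H y).open_source.mem_nhds (mem_chart_source H y)] with z hz
  simp only [Pi.add_apply, deriv₁_linFun hz, add_apply]

theorem deriv₂_linFun_add_eventuallyEq (π : TField₂ I M) (y : M)
    (α α' β : TangentSpace I y →L[𝕜] 𝕜) :
    deriv₂ I π (linFun I y (α + α')) (linFun I y β) =ᶠ[𝓝 y]
      deriv₂ I π (linFun I y α) (linFun I y β) + deriv₂ I π (linFun I y α') (linFun I y β) := by
  filter_upwards [(chartAt H y).open_source.mem_nhds (mem_chart_source H y)] with z hz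
  simp only [Pi.add_apply, deriv₂_eq, mvfderiv_linFun hz, ContinuousLinearMap.add_comp, map_add,
    LinearMap.add_apply]

omit [IsManifold I ∞ M] in
theorem schouten₁₂_skew {X : VField I M} {π : TField₂ I M}
    (hπ : ∀ y, flip 𝕜 (π y) = -π y) (y : M) (α β : TangentSpace I y →L[𝕜] 𝕜) :
    schouten₁₂ I X π y α β = -schouten₁₂ I X π y β α := by
  simp only [schouten₁₂]
  rw [deriv₂_skew hπ (linFun I y α), deriv₂_skew hπ (deriv₁ I X (linFun I y α)),
    deriv₂_skew hπ (linFun I y α) (deriv₁ I X (linFun I y β))]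
  simp only [deriv₁, mvfderiv_neg, Pi.neg_apply, neg_apply]
  ring

theorem schouten₁₂_eq (X : VField I M) (π : TField₂ I M) (y : M)
    (α β : TangentSpace I y →L[𝕜] 𝕜) :
    schouten₁₂ I X π y α β =
      mvfderiv I (deriv₂ I π (linFun I y α) (linFun I y β)) y (X y)
        - pairₗ (π y) (mvfderiv I (deriv₁ I X (linFun I y α)) y) β
        - pairₗ (π y) α (mvfderiv I (deriv₁ I X (linFun I y β)) y) := by
  simp only [schouten₁₂, deriv₂_eq, mvfderiv_linFun_self, deriv₁]

theorem schouten₂₂_self_eq (π : TField₂ I M) (y : M) (α β γ : TangentSpace I y →L[𝕜] 𝕜) :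
    schouten₂₂ I π π y α β γ =
      2 * (pairₗ (π y) α (mvfderiv I (deriv₂ I π (linFun I y β) (linFun I y γ)) y)
        + pairₗ (π y) β (mvfderiv I (deriv₂ I π (linFun I y γ) (linFun I y α)) y)
        + pairₗ (π y) γ (mvfderiv I (deriv₂ I π (linFun I y α) (linFun I y β)) y)) := by
  simp only [schouten₂₂]
  rw [deriv₂_eq π (linFun I y α), deriv₂_eq π (linFun I y β), deriv₂_eq π (linFun I y γ)]
  simp only [mvfderiv_linFun_self]
  ring

theorem mvfderiv_deriv₁_linFun_add {X : VField I M}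
    (hX : ContMDiff I I.tangent ∞ (fun y => (⟨y, X y⟩ : TangentBundle I M)))
    (y : M) (α α' : TangentSpace I y →L[𝕜] 𝕜) :
    mvfderiv I (deriv₁ I X (linFun I y (α + α'))) y =
      mvfderiv I (deriv₁ I X (linFun I y α)) y + mvfderiv I (deriv₁ I X (linFun I y α')) y :=
  (mvfderiv_congr (deriv₁_linFun_add_eventuallyEq X y α α')).trans
    (mvfderiv_add (mdifferentiableAt_deriv₁_linFun hX y α)
      (mdifferentiableAt_deriv₁_linFun hX y α'))

theorem mvfderiv_deriv₂_linFun_add_left {π : TField₂ I M} (hπ : IsBivector I π) (y : M)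
    (α α' β : TangentSpace I y →L[𝕜] 𝕜) :
    mvfderiv I (deriv₂ I π (linFun I y (α + α')) (linFun I y β)) y =
      mvfderiv I (deriv₂ I π (linFun I y α) (linFun I y β)) y
        + mvfderiv I (deriv₂ I π (linFun I y α') (linFun I y β)) y :=
  (mvfderiv_congr (deriv₂_linFun_add_eventuallyEq π y α α' β)).trans
    (mvfderiv_add (mdifferentiableAt_deriv₂_linFun hπ y α β)
      (mdifferentiableAt_deriv₂_linFun hπ y α' β))

theorem mvfderiv_deriv₂_linFun_add_right {π : TField₂ I M} (hπ : IsBivector I π) (y : M)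
    (α α' β : TangentSpace I y →L[𝕜] 𝕜) :
    mvfderiv I (deriv₂ I π (linFun I y β) (linFun I y (α + α'))) y =
      mvfderiv I (deriv₂ I π (linFun I y β) (linFun I y α)) y
        + mvfderiv I (deriv₂ I π (linFun I y β) (linFun I y α')) y := by
  simp only [deriv₂_skew hπ.skew (linFun I y β), mvfderiv_neg,
    mvfderiv_deriv₂_linFun_add_left hπ, neg_add]

theorem schouten₁₂_add_left {X : VField I M} {π : TField₂ I M}
    (hX : ContMDiff I I.tangent ∞ (fun y => (⟨y, X y⟩ : TangentBundle I M)))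
    (hπ : IsBivector I π) (y : M) (α α' β : TangentSpace I y →L[𝕜] 𝕜) :
    schouten₁₂ I X π y (α + α') β = schouten₁₂ I X π y α β + schouten₁₂ I X π y α' β := by
  simp only [schouten₁₂_eq, mvfderiv_deriv₁_linFun_add hX, mvfderiv_deriv₂_linFun_add_left hπ,
    map_add, LinearMap.add_apply, add_apply]
  ring

theorem schouten₁₂_add_right {X : VField I M} {π : TField₂ I M}
    (hX : ContMDiff I I.tangent ∞ (fun y => (⟨y, X y⟩ : TangentBundle I M)))
    (hπ : IsBivector I π) (y : M) (α β β' : TangentSpace I y →L[𝕜] 𝕜) :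
    schouten₁₂ I X π y α (β + β') = schouten₁₂ I X π y α β + schouten₁₂ I X π y α β' := by
  simp only [schouten₁₂_skew hπ.skew y α, schouten₁₂_add_left hX hπ, neg_add]

theorem schouten₂₂_add_left {π : TField₂ I M}
    (hπ : IsBivector I π) (y : M) (α α' β γ : TangentSpace I y →L[𝕜] 𝕜) :
    schouten₂₂ I π π y (α + α') β γ = schouten₂₂ I π π y α β γ + schouten₂₂ I π π y α' β γ := by
  simp only [schouten₂₂_self_eq, mvfderiv_deriv₂_linFun_add_left hπ,
    mvfderiv_deriv₂_linFun_add_right hπ, map_add, LinearMap.add_apply]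
  ring

omit [IsManifold I ∞ M] in
-- Rotation transports additivity from the first slot to the others and reduces the number of index
-- patterns in the Jacobi identity.
theorem schouten₂₂_cyclic (π : TField₂ I M) (y : M) (α β γ : TangentSpace I y →L[𝕜] 𝕜) :
    schouten₂₂ I π π y α β γ = schouten₂₂ I π π y β γ α := by
  simp only [schouten₂₂]
  ring

end

end Schouten

/-! ### The Yang-Baxter expression with three independent tensors -/

section YangBaxter

variable {𝕜 : Type*} [RCLike 𝕜] {𝔤 : Type*} [LieRing 𝔤] [LieAlgebra 𝕜 𝔤]

/-- The bilinear map `(a, b) ↦ [a₁₂, b₁₃]`. -/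
def br₁₂₁₃ : 𝔤 ⊗[𝕜] 𝔤 →ₗ[𝕜] 𝔤 ⊗[𝕜] 𝔤 →ₗ[𝕜] 𝔤 ⊗[𝕜] (𝔤 ⊗[𝕜] 𝔤) :=
  TensorProduct.curry (TensorProduct.map (bracketMap 𝕜) LinearMap.id ∘ₗ
    (TensorProduct.tensorTensorTensorComm 𝕜 𝔤 𝔤 𝔤 𝔤).toLinearMap)

/-- The bilinear map `(a, b) ↦ [a₁₂, b₂₃]`. -/
def br₁₂₂₃ : 𝔤 ⊗[𝕜] 𝔤 →ₗ[𝕜] 𝔤 ⊗[𝕜] 𝔤 →ₗ[𝕜] 𝔤 ⊗[𝕜] (𝔤 ⊗[𝕜] 𝔤) :=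
  TensorProduct.curry (TensorProduct.map LinearMap.id
    (TensorProduct.map (bracketMap 𝕜) LinearMap.id ∘ₗ
      (TensorProduct.assoc 𝕜 𝔤 𝔤 𝔤).symm.toLinearMap) ∘ₗ
    (TensorProduct.assoc 𝕜 𝔤 𝔤 (𝔤 ⊗[𝕜] 𝔤)).toLinearMap)

/-- The bilinear map `(a, b) ↦ [a₁₃, b₂₃]`. -/
def br₁₃₂₃ : 𝔤 ⊗[𝕜] 𝔤 →ₗ[𝕜] 𝔤 ⊗[𝕜] 𝔤 →ₗ[𝕜] 𝔤 ⊗[𝕜] (𝔤 ⊗[𝕜] 𝔤) :=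
  TensorProduct.curry ((TensorProduct.assoc 𝕜 𝔤 𝔤 𝔤).toLinearMap ∘ₗ
    TensorProduct.map LinearMap.id (bracketMap 𝕜) ∘ₗ
    (TensorProduct.tensorTensorTensorComm 𝕜 𝔤 𝔤 𝔤 𝔤).toLinearMap)

@[simp]
theorem br₁₂₁₃_tmul (a a' b b' : 𝔤) :
    br₁₂₁₃ (a ⊗ₜ[𝕜] a') (b ⊗ₜ[𝕜] b') = ⁅a, b⁆ ⊗ₜ[𝕜] (a' ⊗ₜ[𝕜] b') := by
  simp [br₁₂₁₃, bracketMap]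

@[simp]
theorem br₁₂₂₃_tmul (a a' b b' : 𝔤) :
    br₁₂₂₃ (a ⊗ₜ[𝕜] a') (b ⊗ₜ[𝕜] b') = a ⊗ₜ[𝕜] (⁅a', b⁆ ⊗ₜ[𝕜] b') := by
  simp [br₁₂₂₃, bracketMap]

@[simp]
theorem br₁₃₂₃_tmul (a a' b b' : 𝔤) :
    br₁₃₂₃ (a ⊗ₜ[𝕜] a') (b ⊗ₜ[𝕜] b') = a ⊗ₜ[𝕜] (b ⊗ₜ[𝕜] ⁅a', b'⁆) := by
  simp [br₁₃₂₃, bracketMap]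

/-- `[a₁₂, b₁₃] + [a₁₂, c₂₃] + [b₁₃, c₂₃]`. -/
def cyb₃ (a b c : 𝔤 ⊗[𝕜] 𝔤) : 𝔤 ⊗[𝕜] (𝔤 ⊗[𝕜] 𝔤) := br₁₂₁₃ a b + br₁₂₂₃ a c + br₁₃₂₃ b c

theorem CYB_eq_cyb₃ (r : 𝔤 ⊗[𝕜] 𝔤) : CYB 𝕜 r = cyb₃ r r r :=
  rfl

theorem flip_flip {V : Type*} [AddCommGroup V] [Module 𝕜 V] (t : V ⊗[𝕜] V) :
    flip 𝕜 (flip 𝕜 t) = t := by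
  simp [flip]

/-- For `a = x ⊗ y` the sum is `x ⊗ ad_y Ω`. This permits changing the third argument of `cyb₃` by
`Ω` when the first two agree. -/
theorem br₁₂₂₃_add_br₁₃₂₃_of_invariant {Ω : 𝔤 ⊗[𝕜] 𝔤} (hΩ : ∀ x : 𝔤, ⁅x, Ω⁆ = 0)
    (a : 𝔤 ⊗[𝕜] 𝔤) : br₁₂₂₃ a Ω + br₁₃₂₃ a Ω = 0 := by
  induction a with
  | zero => simp
  | add a b ha hb =>
    rw [map_add, map_add, LinearMap.add_apply, LinearMap.add_apply, add_add_add_comm, ha, hb,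
      add_zero]
  | tmul x y =>
    have : ∀ t : 𝔤 ⊗[𝕜] 𝔤, br₁₂₂₃ (x ⊗ₜ[𝕜] y) t + br₁₃₂₃ (x ⊗ₜ[𝕜] y) t = x ⊗ₜ[𝕜] ⁅y, t⁆ := by
      intro t
      induction t with
      | zero => simp
      | add a b ha hb => rw [map_add, map_add, lie_add, TensorProduct.tmul_add, ← ha, ← hb]; abel
      | tmul u v => simp [TensorProduct.LieModule.lie_tmul_right, TensorProduct.tmul_add]
    rw [this, hΩ, TensorProduct.tmul_zero]

/-- For `a = x ⊗ y` the sum is `-(ad_x Ω) ⊗ y`. This permits changing the first argument of `cyb₃`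
by `Ω` when the last two agree. -/
theorem br₁₂₁₃_add_br₁₂₂₃_of_invariant {Ω : 𝔤 ⊗[𝕜] 𝔤} (hΩ : ∀ x : 𝔤, ⁅x, Ω⁆ = 0)
    (a : 𝔤 ⊗[𝕜] 𝔤) : br₁₂₁₃ Ω a + br₁₂₂₃ Ω a = 0 := by
  induction a with
  | zero => simp
  | add a b ha hb => rw [map_add, map_add, add_add_add_comm, ha, hb, add_zero]
  | tmul x y =>
    have : ∀ t : 𝔤 ⊗[𝕜] 𝔤, br₁₂₁₃ t (x ⊗ₜ[𝕜] y) + br₁₂₂₃ t (x ⊗ₜ[𝕜] y) =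
        -TensorProduct.assoc 𝕜 𝔤 𝔤 𝔤 (⁅x, t⁆ ⊗ₜ[𝕜] y) := by
      intro t
      induction t with
      | zero => simp
      | add a b ha hb =>
        simp only [map_add, LinearMap.add_apply, lie_add, TensorProduct.add_tmul, neg_add,
          ← ha, ← hb]
        abel
      | tmul u v =>
        simp only [br₁₂₁₃_tmul, br₁₂₂₃_tmul, TensorProduct.LieModule.lie_tmul_right,
          TensorProduct.add_tmul, map_add, TensorProduct.assoc_tmul, ← lie_skew x u,
          ← lie_skew x v, TensorProduct.neg_tmul, TensorProduct.tmul_neg, neg_add, map_neg, neg_neg]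
    rw [this, hΩ, TensorProduct.zero_tmul, map_zero, neg_zero]

/-- For `a = x ⊗ y` the difference is `ad_x Ω` in slots 1 and 3 with `y` in slot 2. This permits
changing the middle argument of `cyb₃` by `Ω` when the third is minus the flip of the first. -/
theorem br₁₂₁₃_sub_br₁₃₂₃_flip_of_invariant {Ω : 𝔤 ⊗[𝕜] 𝔤} (hΩ : ∀ x : 𝔤, ⁅x, Ω⁆ = 0)
    (a : 𝔤 ⊗[𝕜] 𝔤) : br₁₂₁₃ a Ω - br₁₃₂₃ Ω (flip 𝕜 a) = 0 := by
  induction a with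
  | zero => simp
  | add a b ha hb =>
    rw [map_add, map_add, map_add, LinearMap.add_apply, add_sub_add_comm, ha, hb, add_zero]
  | tmul x y =>
    have : ∀ t : 𝔤 ⊗[𝕜] 𝔤, br₁₂₁₃ (x ⊗ₜ[𝕜] y) t - br₁₃₂₃ t (flip 𝕜 (x ⊗ₜ[𝕜] y)) =
        TensorProduct.leftComm 𝕜 𝔤 𝔤 𝔤 (y ⊗ₜ[𝕜] ⁅x, t⁆) := by
      intro t
      induction t with
      | zero => simp
      | add a b ha hb =>
        simp only [map_add, LinearMap.add_apply, lie_add, TensorProduct.tmul_add, ← ha, ← hb]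
        abel
      | tmul u v =>
        simp only [flip, LinearEquiv.coe_coe, TensorProduct.comm_tmul, br₁₂₁₃_tmul, br₁₃₂₃_tmul,
          TensorProduct.LieModule.lie_tmul_right, TensorProduct.tmul_add, map_add,
          TensorProduct.leftComm_tmul, ← lie_skew v x, TensorProduct.tmul_neg, sub_neg_eq_add]
    rw [this, hΩ, TensorProduct.tmul_zero, map_zero]

namespace IsQuasitriangular

variable {r : 𝔤 ⊗[𝕜] 𝔤} (hr : IsQuasitriangular 𝕜 r)
include hr

theorem invariant (x : 𝔤) : ⁅x, r + flip 𝕜 r⁆ = 0 := by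
  have h := hr.symm_invariant x
  rw [symmPart, lie_smul] at h
  exact (smul_eq_zero.1 h).resolve_left (by norm_num)

theorem lie_neg_flip (x : 𝔤) : ⁅x, -flip 𝕜 r⁆ = ⁅x, r⁆ := by
  have h := hr.invariant x
  rw [lie_add] at h
  rw [lie_neg, neg_eq_iff_add_eq_zero, add_comm, h]

/-- With `s = -r²¹`, the three exchange rules lead from the triple `rrr` to `rrs`, `rss`, `sss`,
`ssr`, and also to `srr`. Only `rsr` and `srs` are out of reach, and the last hypothesis rules them
out. -/
theorem cyb₃_eq_zero {a b c : 𝔤 ⊗[𝕜] 𝔤} (ha : a = r ∨ a = -flip 𝕜 r)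
    (hb : b = r ∨ b = -flip 𝕜 r) (hc : c = r ∨ c = -flip 𝕜 r) (h : a = c → b = a) :
    cyb₃ a b c = 0 := by
  obtain ⟨Ω, hΩ⟩ : ∃ Ω, Ω = r + flip 𝕜 r := ⟨_, rfl⟩
  obtain ⟨s, hs⟩ : ∃ s, s = -flip 𝕜 r := ⟨_, rfl⟩
  have hinv : ∀ x : 𝔤, ⁅x, Ω⁆ = 0 := by rw [hΩ]; exact hr.invariant
  have hrs : r = s + Ω := by rw [hs, hΩ]; abel
  have hfr : flip 𝕜 r = -s := by rw [hs, neg_neg]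
  have hfs : flip 𝕜 s = -r := by rw [hs, map_neg, flip_flip]
  have h1 : ∀ x, cyb₃ x x r = cyb₃ x x s := by
    intro x
    have := br₁₂₂₃_add_br₁₃₂₃_of_invariant hinv x
    have e : cyb₃ x x r = cyb₃ x x s + (br₁₂₂₃ x Ω + br₁₃₂₃ x Ω) := by
      rw [hrs]; simp only [cyb₃, map_add]; abel
    rw [e, this, add_zero]
  have h2 : ∀ x, cyb₃ r x x = cyb₃ s x x := by
    intro x
    have := br₁₂₁₃_add_br₁₂₂₃_of_invariant hinv x
    have e : cyb₃ (s + Ω) x x = cyb₃ s x x + (br₁₂₁₃ Ω x + br₁₂₂₃ Ω x) := by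
      simp only [cyb₃, map_add, LinearMap.add_apply]; abel
    rw [← add_zero (cyb₃ s x x), ← this, ← e, hrs]
  have h3 : ∀ x, cyb₃ x r (-flip 𝕜 x) = cyb₃ x s (-flip 𝕜 x) := by
    intro x
    have := br₁₂₁₃_sub_br₁₃₂₃_flip_of_invariant hinv x
    have e : cyb₃ x (s + Ω) (-flip 𝕜 x) = cyb₃ x s (-flip 𝕜 x) +
        (br₁₂₁₃ x Ω - br₁₃₂₃ Ω (flip 𝕜 x)) := by
      simp only [cyb₃, map_add, LinearMap.add_apply, map_neg]; abel
    rw [← add_zero (cyb₃ x s _), ← this, ← e, ← hrs]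
  have hrrr : cyb₃ r r r = 0 := hr.cyb_eq_zero
  have hrrs : cyb₃ r r s = 0 := by rw [← h1, hrrr]
  have hrss : cyb₃ r s s = 0 := by
    have := h3 r
    rwa [hfr, neg_neg, hrrs, eq_comm] at this
  have hsss : cyb₃ s s s = 0 := by rw [← h2, hrss]
  have hsrr : cyb₃ s r r = 0 := by rw [← h2, hrrr]
  have hssr : cyb₃ s s r = 0 := by rw [h1, hsss]
  rw [← hs] at ha hb hc
  rcases ha with rfl | rfl <;> rcases hb with rfl | rfl <;> rcases hc with rfl | rfl <;>
    first | assumption | skip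
  -- The two remaining cases have equal outer arguments, so `h` makes all three arguments equal.
  · rw [h rfl]; assumption
  · rw [h rfl]; assumption

end IsQuasitriangular

end YangBaxter

/-! ### The blocks of `r⁽ⁿ⁾` and its quasitriangularity -/

section RPow

variable {𝕜 : Type*} [RCLike 𝕜] {𝔤 : Type*} [LieRing 𝔤] [LieAlgebra 𝕜 𝔤] {n : ℕ}

/-- The inclusion `u ⊗ v ↦ (u)_j ⊗ (v)_k`. -/
def incl₂ (j k : Fin n) : 𝔤 ⊗[𝕜] 𝔤 →ₗ[𝕜] (Fin n → 𝔤) ⊗[𝕜] (Fin n → 𝔤) :=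
  TensorProduct.map (incl 𝕜 j) (incl 𝕜 k)

/-- The inclusion `u ⊗ v ⊗ w ↦ (u)_j ⊗ (v)_k ⊗ (w)_l`. -/
def incl₃ (j k l : Fin n) : 𝔤 ⊗[𝕜] (𝔤 ⊗[𝕜] 𝔤) →ₗ[𝕜]
    (Fin n → 𝔤) ⊗[𝕜] ((Fin n → 𝔤) ⊗[𝕜] (Fin n → 𝔤)) :=
  TensorProduct.map (incl 𝕜 j) (incl₂ k l)

variable (𝕜) in
/-- The component of `r⁽ⁿ⁾` in the `j`-th and `k`-th summands. -/
def rComp (r : 𝔤 ⊗[𝕜] 𝔤) (j k : Fin n) : 𝔤 ⊗[𝕜] 𝔤 :=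
  if k < j ∨ (j = k ∧ Even (j : ℕ)) then r else -flip 𝕜 r

theorem rComp_eq_or (r : 𝔤 ⊗[𝕜] 𝔤) (j k : Fin n) :
    rComp 𝕜 r j k = r ∨ rComp 𝕜 r j k = -flip 𝕜 r := by
  unfold rComp; split_ifs <;> simp

theorem rComp_swap (r : 𝔤 ⊗[𝕜] 𝔤) {j k : Fin n} (h : j ≠ k) :
    rComp 𝕜 r k j = -flip 𝕜 (rComp 𝕜 r j k) := by
  rcases lt_or_gt_of_ne h with h' | h' <;> simp [rComp, h, h.symm, h', h'.not_gt, flip_flip]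

theorem sq_incl (j : Fin n) (t : 𝔤 ⊗[𝕜] 𝔤) : sq 𝕜 (incl 𝕜 j) t = incl₂ j j t :=
  rfl

theorem Mix_eq_sum (r : 𝔤 ⊗[𝕜] 𝔤) :
    Mix 𝕜 n r = -∑ j, ∑ k, if j = k then 0 else incl₂ j k (rComp 𝕜 r j k) := by
  have h : ∀ j k : Fin n, (if j < k then MixPair 𝕜 j k r else 0) =
      (if j < k then incl₂ j k (flip 𝕜 r) else 0) - if j < k then incl₂ k j r else 0 := by
    intro j k
    split_ifs <;> simp [MixPair, incl₂]
  simp only [Mix, h, Finset.sum_sub_distrib]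
  rw [Finset.sum_comm (f := fun j k => if j < k then incl₂ k j r else 0)]
  simp only [← Finset.sum_sub_distrib, ← Finset.sum_neg_distrib]
  refine Finset.sum_congr rfl fun j _ => Finset.sum_congr rfl fun k _ => ?_
  rcases lt_trichotomy j k with h' | h' | h'
  · simp [rComp, h', h'.not_gt, h'.ne]
  · simp [h']
  · simp [rComp, h', h'.not_gt, h'.ne']

theorem Alt_eq_sum (r : 𝔤 ⊗[𝕜] 𝔤) : Alt 𝕜 n r = ∑ j, incl₂ j j (rComp 𝕜 r j j) := by
  simp [Alt, rComp, sq_incl]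

theorem rPow_eq_sum (r : 𝔤 ⊗[𝕜] 𝔤) :
    rPow 𝕜 n r = ∑ j, ∑ k, incl₂ j k (rComp 𝕜 r j k) := by
  rw [rPow, Mix_eq_sum, Alt_eq_sum, sub_neg_eq_add, ← Finset.sum_add_distrib]
  refine Finset.sum_congr rfl fun j _ => ?_
  have h : incl₂ j j (rComp 𝕜 r j j) = ∑ k, if j = k then incl₂ j k (rComp 𝕜 r j k) else 0 := by
    simp
  rw [h, ← Finset.sum_add_distrib]
  refine Finset.sum_congr rfl fun k _ => ?_
  split_ifs <;> simp

theorem lie_incl (x : Fin n → 𝔤) (j : Fin n) (y : 𝔤) :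
    ⁅x, incl 𝕜 j y⁆ = incl 𝕜 j ⁅x j, y⁆ := by
  funext k
  change ⁅x k, incl 𝕜 j y k⁆ = _
  rcases eq_or_ne k j with rfl | h
  · simp [incl]
  · simp [incl, h]

theorem incl_lie_incl (j k : Fin n) (x y : 𝔤) :
    ⁅incl 𝕜 j x, incl 𝕜 k y⁆ = if j = k then incl 𝕜 j ⁅x, y⁆ else 0 := by
  rw [lie_incl]
  split_ifs with h
  · subst h; simp [incl]
  · simp [incl, Pi.single_eq_of_ne (Ne.symm h)]

/-- Transitivity of the order excludes the bad patterns: if the blocks `j, k` and `k, l` are both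
`r`, then `l ≤ k ≤ j`, with equality only at an even index, so the block `j, l` is `r` too; likewise
for `-r²¹`. -/
theorem IsQuasitriangular.cyb₃_rComp {r : 𝔤 ⊗[𝕜] 𝔤} (hr : IsQuasitriangular 𝕜 r)
    (j k l : Fin n) : cyb₃ (rComp 𝕜 r j k) (rComp 𝕜 r j l) (rComp 𝕜 r k l) = 0 := by
  refine hr.cyb₃_eq_zero (rComp_eq_or r _ _) (rComp_eq_or r _ _) (rComp_eq_or r _ _) ?_
  -- If the two possible values coincide there is nothing to check; otherwise the value of a block
  -- determines the order condition that produced it.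
  by_cases h : -flip 𝕜 r = r
  · simp [rComp, h]
  · have h' := Ne.symm h
    unfold rComp
    grind

theorem br₁₂₁₃_incl₂ (j k j' l : Fin n) (a b : 𝔤 ⊗[𝕜] 𝔤) :
    br₁₂₁₃ (incl₂ j k a) (incl₂ j' l b) = if j = j' then incl₃ j k l (br₁₂₁₃ a b) else 0 := by
  induction a with
  | zero => simp
  | add a a' h h' => simp only [map_add, LinearMap.add_apply, h, h']; split_ifs <;> simp
  | tmul x y =>
    induction b with
    | zero => simp
    | add b b' h h' => simp only [map_add, h, h']; split_ifs <;> simp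
    | tmul u v =>
      simp only [incl₂, incl₃, TensorProduct.map_tmul, br₁₂₁₃_tmul, incl_lie_incl]
      split_ifs <;> simp

theorem br₁₂₂₃_incl₂ (j k k' l : Fin n) (a b : 𝔤 ⊗[𝕜] 𝔤) :
    br₁₂₂₃ (incl₂ j k a) (incl₂ k' l b) = if k = k' then incl₃ j k l (br₁₂₂₃ a b) else 0 := by
  induction a with
  | zero => simp
  | add a a' h h' => simp only [map_add, LinearMap.add_apply, h, h']; split_ifs <;> simp
  | tmul x y =>
    induction b with
    | zero => simp
    | add b b' h h' => simp only [map_add, h, h']; split_ifs <;> simp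
    | tmul u v =>
      simp only [incl₂, incl₃, TensorProduct.map_tmul, br₁₂₂₃_tmul, incl_lie_incl]
      split_ifs <;> simp

theorem br₁₃₂₃_incl₂ (j l k l' : Fin n) (a b : 𝔤 ⊗[𝕜] 𝔤) :
    br₁₃₂₃ (incl₂ j l a) (incl₂ k l' b) = if l = l' then incl₃ j k l (br₁₃₂₃ a b) else 0 := by
  induction a with
  | zero => simp
  | add a a' h h' => simp only [map_add, LinearMap.add_apply, h, h']; split_ifs <;> simp
  | tmul x y =>
    induction b with
    | zero => simp
    | add b b' h h' => simp only [map_add, h, h']; split_ifs <;> simp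
    | tmul u v =>
      simp only [incl₂, incl₃, TensorProduct.map_tmul, br₁₃₂₃_tmul, incl_lie_incl]
      split_ifs <;> simp

/-- Distinct summands of `𝔤ⁿ` commute, so each of the three brackets forces two of its four indices
to agree. The three indices left are those of the slots. -/
theorem CYB_sum_incl₂ (R : Fin n → Fin n → 𝔤 ⊗[𝕜] 𝔤) :
    CYB 𝕜 (∑ j, ∑ k, incl₂ j k (R j k)) =
      ∑ j, ∑ k, ∑ l, incl₃ j k l (cyb₃ (R j k) (R j l) (R k l)) := by
  have h1 : br₁₂₁₃ (∑ j, ∑ k, incl₂ j k (R j k)) (∑ j, ∑ k, incl₂ j k (R j k)) =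
      ∑ j, ∑ k, ∑ l, incl₃ j k l (br₁₂₁₃ (R j k) (R j l)) := by
    simp only [map_sum, LinearMap.sum_apply, br₁₂₁₃_incl₂]
    refine Finset.sum_congr rfl fun j _ => ?_
    conv_rhs => rw [Finset.sum_comm]
    refine Finset.sum_congr rfl fun l _ => ?_
    rw [Finset.sum_comm]
    simp
  have h2 : br₁₂₂₃ (∑ j, ∑ k, incl₂ j k (R j k)) (∑ j, ∑ k, incl₂ j k (R j k)) =
      ∑ j, ∑ k, ∑ l, incl₃ j k l (br₁₂₂₃ (R j k) (R k l)) := by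
    simp only [map_sum, LinearMap.sum_apply, br₁₂₂₃_incl₂]
    conv_rhs => rw [Finset.sum_comm]
    refine Finset.sum_congr rfl fun k _ => ?_
    conv_rhs => rw [Finset.sum_comm]
    simp
  have h3 : br₁₃₂₃ (∑ j, ∑ k, incl₂ j k (R j k)) (∑ j, ∑ k, incl₂ j k (R j k)) =
      ∑ j, ∑ k, ∑ l, incl₃ j k l (br₁₃₂₃ (R j l) (R k l)) := by
    simp only [map_sum, LinearMap.sum_apply, br₁₃₂₃_incl₂]
    conv_rhs => rw [Finset.sum_comm]
    refine Finset.sum_congr rfl fun k _ => ?_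
    conv_rhs => rw [Finset.sum_comm]
    simp
  rw [CYB_eq_cyb₃, cyb₃, h1, h2, h3]
  simp only [cyb₃, map_add, Finset.sum_add_distrib]

theorem lie_incl₂ (x : Fin n → 𝔤) (j k : Fin n) (t : 𝔤 ⊗[𝕜] 𝔤) :
    ⁅x, incl₂ j k t⁆ = incl₂ j k
      (TensorProduct.map (LieAlgebra.ad 𝕜 𝔤 (x j)) LinearMap.id t
        + TensorProduct.map LinearMap.id (LieAlgebra.ad 𝕜 𝔤 (x k)) t) := by
  induction t with
  | zero => simp
  | add a b ha hb => simp only [map_add, lie_add, ha, hb]; abel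
  | tmul u v =>
    simp [incl₂, TensorProduct.LieModule.lie_tmul_right, lie_incl]

theorem lie_eq_map_ad (x : 𝔤) (t : 𝔤 ⊗[𝕜] 𝔤) :
    ⁅x, t⁆ = TensorProduct.map (LieAlgebra.ad 𝕜 𝔤 x) LinearMap.id t
        + TensorProduct.map LinearMap.id (LieAlgebra.ad 𝕜 𝔤 x) t := by
  induction t with
  | zero => simp
  | add a b ha hb => simp only [map_add, lie_add, ha, hb]; abel
  | tmul u v => simp [TensorProduct.LieModule.lie_tmul_right]

theorem IsQuasitriangular.lie_rComp {r : 𝔤 ⊗[𝕜] 𝔤} (hr : IsQuasitriangular 𝕜 r) (x : 𝔤)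
    (j k : Fin n) : ⁅x, rComp 𝕜 r j k⁆ = ⁅x, r⁆ := by
  rcases rComp_eq_or r j k with h | h <;> rw [h]
  exact hr.lie_neg_flip x

theorem flip_incl₂ (j k : Fin n) (t : 𝔤 ⊗[𝕜] 𝔤) :
    flip 𝕜 (incl₂ j k t) = incl₂ k j (flip 𝕜 t) := by
  induction t with
  | zero => simp
  | add a b ha hb => simp only [map_add, ha, hb]
  | tmul u v => simp [flip, incl₂]

theorem flip_Mix (r : 𝔤 ⊗[𝕜] 𝔤) : flip 𝕜 (Mix 𝕜 n r) = -Mix 𝕜 n r := by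
  simp only [Mix_eq_sum, map_neg, map_sum, neg_neg]
  rw [neg_eq_iff_eq_neg, Finset.sum_comm]
  simp only [← Finset.sum_neg_distrib]
  refine Finset.sum_congr rfl fun j _ => Finset.sum_congr rfl fun k _ => ?_
  rcases eq_or_ne j k with rfl | h
  · simp
  · simp [h, h.symm, flip_incl₂, rComp_swap r h, flip_flip]

theorem IsQuasitriangular.rPow {r : 𝔤 ⊗[𝕜] 𝔤} (hr : IsQuasitriangular 𝕜 r) (n : ℕ) :
    IsQuasitriangular 𝕜 (rPow 𝕜 n r) where
  symm_invariant x := by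
    -- `Mix` is skew, so only the diagonal blocks contribute, each by `±(r + r²¹)`.
    have h : symmPart 𝕜 (PoissonFusion.rPow 𝕜 n r) = (2 : 𝕜)⁻¹ •
        ∑ j, incl₂ j j (rComp 𝕜 r j j + flip 𝕜 (rComp 𝕜 r j j)) := by
      rw [symmPart, PoissonFusion.rPow, map_sub, flip_Mix, Alt_eq_sum]
      simp only [map_sum, map_add, Finset.sum_add_distrib, flip_incl₂]
      congr 1
      abel
    rw [h, lie_smul, lie_sum, Finset.sum_eq_zero, smul_zero]
    intro j _
    rw [lie_incl₂, ← lie_eq_map_ad]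
    rcases rComp_eq_or r j j with h | h <;> rw [h]
    · rw [hr.invariant, map_zero]
    · rw [map_neg, flip_flip, ← neg_add, lie_neg, add_comm, hr.invariant, neg_zero, map_zero]
  cyb_eq_zero := by
    rw [rPow_eq_sum, CYB_sum_incl₂]
    simp [hr.cyb₃_rComp]

theorem sq_diag (t : 𝔤 ⊗[𝕜] 𝔤) : sq 𝕜 (diag 𝕜 n) t = ∑ j : Fin n, ∑ k : Fin n, incl₂ j k t := by
  have h : (diag 𝕜 n : 𝔤 →ₗ[𝕜] Fin n → 𝔤) = ∑ j, incl 𝕜 j := by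
    ext x i
    simp [diag, incl, Finset.sum_apply, Pi.single_apply]
  induction t with
  | zero => simp
  | add a b ha hb => simp only [map_add, ha, hb, Finset.sum_add_distrib]
  | tmul u v =>
    simp only [sq, incl₂, TensorProduct.map_tmul, h, LinearMap.sum_apply, TensorProduct.sum_tmul,
      TensorProduct.tmul_sum]
    rw [Finset.sum_comm]

/-- A diagonal element acts on every block by the same `ad_x`, and `ad_x` does not distinguish `r`
from `-r²¹`. -/
theorem IsQuasitriangular.lie_diag_rPow {r : 𝔤 ⊗[𝕜] 𝔤} (hr : IsQuasitriangular 𝕜 r) (n : ℕ)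
    (x : 𝔤) : ⁅diag 𝕜 n x, PoissonFusion.rPow 𝕜 n r⁆ = sq 𝕜 (diag 𝕜 n) ⁅x, r⁆ := by
  rw [rPow_eq_sum, sq_diag, lie_sum]
  refine Finset.sum_congr rfl fun j _ => ?_
  rw [lie_sum]
  refine Finset.sum_congr rfl fun k _ => ?_
  rw [lie_incl₂, ← hr.lie_rComp x j k, lie_eq_map_ad]
  rfl

end RPow

/-! ### Tangent vectors, functions and tensors on the product manifold -/

section ProductManifold

open Set Filter Topology VectorField

variable {𝕜 : Type*} [RCLike 𝕜] {n : ℕ}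
  {E : Fin n → Type*} [∀ j, NormedAddCommGroup (E j)] [∀ j, NormedSpace 𝕜 (E j)]
  {H : Fin n → Type*} [∀ j, TopologicalSpace (H j)] {I : ∀ j, ModelWithCorners 𝕜 (E j) (H j)}
  {Y : Fin n → Type*} [∀ j, TopologicalSpace (Y j)] [∀ j, ChartedSpace (H j) (Y j)]

variable (I) in
/-- The projection of `T_y (∏ Y_j)` onto `T_{y_j} Y_j`. -/
def tangentProj (y : ∀ j, Y j) (j : Fin n) :
    TangentSpace (ModelWithCorners.pi I) y →L[𝕜] TangentSpace (I j) (y j) :=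
  (ContinuousLinearMap.proj j : (∀ j, E j) →L[𝕜] E j)

theorem tangentProj_tangentIncl_self (y : ∀ j, Y j) (j : Fin n) (v : TangentSpace (I j) (y j)) :
    tangentProj I y j (tangentIncl y j v) = v :=
  Pi.single_eq_same (M := E) j v

theorem tangentProj_tangentIncl_of_ne (y : ∀ j, Y j) {j k : Fin n} (h : j ≠ k)
    (v : TangentSpace (I k) (y k)) : tangentProj I y j (tangentIncl y k v) = 0 :=
  Pi.single_eq_of_ne (M := E) h v

theorem tangentSpace_ext {y : ∀ j, Y j} {v w : TangentSpace (ModelWithCorners.pi I) y}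
    (h : ∀ j, tangentProj I y j v = tangentProj I y j w) : v = w :=
  funext (β := E) h

/-- The preferred chart of the product is the product of the preferred charts, so the test function
of a pulled back covector is itself pulled back. -/
theorem linFun_tangentProj (y : ∀ j, Y j) (j : Fin n) (α : TangentSpace (I j) (y j) →L[𝕜] 𝕜) :
    linFun (ModelWithCorners.pi I) y (α ∘L tangentProj I y j) =
      fun z => linFun (I j) (y j) α (z j) :=
  rfl

theorem exists_eq_sum_tangentProj (y : ∀ j, Y j)
    (α : TangentSpace (ModelWithCorners.pi I) y →L[𝕜] 𝕜) :
    ∃ β : ∀ j, TangentSpace (I j) (y j) →L[𝕜] 𝕜, α = ∑ j, β j ∘L tangentProj I y j := by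
  let a : (∀ j, E j) →L[𝕜] 𝕜 := α
  refine ⟨fun j => a ∘L ContinuousLinearMap.single 𝕜 E j, ?_⟩
  have : a = ∑ j, (a ∘L ContinuousLinearMap.single 𝕜 E j) ∘L ContinuousLinearMap.proj j := by
    ext v
    simp only [sum_apply, ContinuousLinearMap.comp_apply]
    rw [← map_sum]
    congr 1
    exact (Finset.univ_sum_single v).symm
  exact this

theorem mem_chartAt_pi_source {y z : ∀ j, Y j} :
    z ∈ (chartAt (ModelPi H) y).source ↔ ∀ j, z j ∈ (chartAt (H j) (y j)).source := by
  rw [piChartedSpace_chartAt]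
  exact Set.mem_univ_pi

section
variable [∀ j, IsManifold (I j) ∞ (Y j)]

omit [∀ j, IsManifold (I j) ∞ (Y j)] in
theorem contMDiff_eval (j : Fin n) :
    ContMDiff (ModelWithCorners.pi I) (I j) ∞ (fun z : ∀ j, Y j => z j) := by
  intro y
  rw [contMDiffAt_iff_target]
  refine ⟨(continuous_apply j).continuousAt, ?_⟩
  exact (ContinuousLinearMap.proj (R := 𝕜) (φ := E) j).contMDiff.contMDiffAt.comp y
    (contMDiffAt_extChartAt (I := ModelWithCorners.pi I) (n := ∞))

omit [∀ j, IsManifold (I j) ∞ (Y j)] in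
theorem mdifferentiableAt_eval (j : Fin n) (y : ∀ j, Y j) :
    MDifferentiableAt (ModelWithCorners.pi I) (I j) (fun z : ∀ j, Y j => z j) y :=
  (contMDiff_eval j y).mdifferentiableAt (by simp)

/-- Evaluation followed by the chart of `Y j` is the product chart followed by the linear
projection. Both charts have identity differential at the base point, so comparing the two chain
rules gives the claim. -/
theorem mfderiv_eval (j : Fin n) (y : ∀ j, Y j) :
    mfderiv (ModelWithCorners.pi I) (I j) (fun z : ∀ j, Y j => z j) y = tangentProj I y j := by
  have h1 := mfderiv_comp y (mdifferentiableAt_extChartAt (I := I j) (mem_chart_source _ (y j)))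
    (mdifferentiableAt_eval (I := I) j y)
  have h2 := mfderiv_comp (I := ModelWithCorners.pi I) (I' := 𝓘(𝕜, ∀ j, E j)) (I'' := 𝓘(𝕜, E j)) y
    (ContinuousLinearMap.proj (R := 𝕜) (φ := E) j).mdifferentiableAt
    (mdifferentiableAt_extChartAt (I := ModelWithCorners.pi I) (mem_chart_source _ y))
  rw [mfderiv_extChartAt_self] at h1
  rw [mfderiv_extChartAt_self, ContinuousLinearMap.mfderiv_eq] at h2
  exact h1.symm.trans h2

theorem mvfderiv_comp_eval {j : Fin n} {f : Y j → 𝕜} {y : ∀ j, Y j}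
    (hf : MDifferentiableAt (I j) 𝓘(𝕜, 𝕜) f (y j)) :
    mvfderiv (ModelWithCorners.pi I) (fun z : ∀ j, Y j => f (z j)) y =
      mvfderiv (I j) f (y j) ∘L tangentProj I y j := by
  have := mvfderiv_comp y hf (mdifferentiableAt_eval (I := I) j y)
  rw [mfderiv_eval] at this
  exact this

omit [∀ j, IsManifold (I j) ∞ (Y j)] in
theorem mdifferentiableAt_comp_eval {j : Fin n} {f : Y j → 𝕜} {y : ∀ j, Y j}
    (hf : MDifferentiableAt (I j) 𝓘(𝕜, 𝕜) f (y j)) :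
    MDifferentiableAt (ModelWithCorners.pi I) 𝓘(𝕜, 𝕜) (fun z : ∀ j, Y j => f (z j)) y :=
  hf.comp y (mdifferentiableAt_eval (I := I) j y)

end

variable {𝔤 : Type*} [LieRing 𝔤] [LieAlgebra 𝕜 𝔤]

/-- The linear form `x ↦ α(σ(x))` on `𝔤` for a covector `α` at `y`. -/
def evalAction {E : Type*} [NormedAddCommGroup E] [NormedSpace 𝕜 E]
    {H : Type*} [TopologicalSpace H] {I : ModelWithCorners 𝕜 E H}
    {M : Type*} [TopologicalSpace M] [ChartedSpace H M] (σ : 𝔤 →ₗ[𝕜] VField I M) (y : M)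
    (α : TangentSpace I y →L[𝕜] 𝕜) : 𝔤 →ₗ[𝕜] 𝕜 :=
  (α : TangentSpace I y →ₗ[𝕜] 𝕜) ∘ₗ LinearMap.proj y ∘ₗ σ

theorem evalAction_apply {E : Type*} [NormedAddCommGroup E] [NormedSpace 𝕜 E]
    {H : Type*} [TopologicalSpace H] {I : ModelWithCorners 𝕜 E H}
    {M : Type*} [TopologicalSpace M] [ChartedSpace H M] (σ : 𝔤 →ₗ[𝕜] VField I M) (y : M)
    (α : TangentSpace I y →L[𝕜] 𝕜) (x : 𝔤) : evalAction σ y α x = α (σ x y) :=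
  rfl

theorem pair_actTensor {E : Type*} [NormedAddCommGroup E] [NormedSpace 𝕜 E]
    {H : Type*} [TopologicalSpace H] {I : ModelWithCorners 𝕜 E H}
    {M : Type*} [TopologicalSpace M] [ChartedSpace H M] (σ : 𝔤 →ₗ[𝕜] VField I M) (y : M)
    (α β : TangentSpace I y →L[𝕜] 𝕜) (t : 𝔤 ⊗[𝕜] 𝔤) :
    pair I (actTensor σ t y) α β = ev (evalAction σ y α) (evalAction σ y β) t := by
  rw [pair_eq_ev, actTensor, ev_sq]
  rfl

variable (lam : ∀ j, 𝔤 →ₗ[𝕜] VField (I j) (Y j))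

theorem tangentProj_prodAction (x : Fin n → 𝔤) (y : ∀ j, Y j) (j : Fin n) :
    tangentProj I y j (prodAction lam x y) = lam j (x j) (y j) := by
  have : prodAction lam x y = ∑ k, tangentIncl y k (lam k (x k) (y k)) := by
    simp [prodAction]
  rw [this, map_sum, Finset.sum_eq_single j]
  · exact tangentProj_tangentIncl_self y j _
  · exact fun k _ hk => tangentProj_tangentIncl_of_ne y hk.symm _
  · simp

theorem evalAction_prodAction (y : ∀ j, Y j) (j : Fin n)
    (α : TangentSpace (I j) (y j) →L[𝕜] 𝕜) :
    evalAction (prodAction lam) y (α ∘L tangentProj I y j) =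
      evalAction (lam j) (y j) α ∘ₗ LinearMap.proj j := by
  refine LinearMap.ext fun x => ?_
  exact congrArg α (tangentProj_prodAction lam x y j)

theorem pair_actTensor_prodAction_incl₂ (y : ∀ j, Y j) (j k j' k' : Fin n)
    (α : TangentSpace (I j) (y j) →L[𝕜] 𝕜) (β : TangentSpace (I k) (y k) →L[𝕜] 𝕜)
    (t : 𝔤 ⊗[𝕜] 𝔤) :
    pair (ModelWithCorners.pi I) (actTensor (prodAction lam) (incl₂ j' k' t) y)
        (α ∘L tangentProj I y j) (β ∘L tangentProj I y k) =
      if j' = j ∧ k' = k then ev (evalAction (lam j) (y j) α) (evalAction (lam k) (y k) β) t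
        else 0 := by
  have h0 : ∀ {j j' : Fin n}, j' ≠ j →
      (LinearMap.proj j : (Fin n → 𝔤) →ₗ[𝕜] 𝔤) ∘ₗ incl 𝕜 j' = 0 := by
    intro j j' h; ext x; simp [incl, h.symm]
  have h1 : ∀ j : Fin n, (LinearMap.proj j : (Fin n → 𝔤) →ₗ[𝕜] 𝔤) ∘ₗ incl 𝕜 j = LinearMap.id := by
    intro j; ext x; simp [incl]
  rw [pair_actTensor, evalAction_prodAction, evalAction_prodAction, incl₂, ev_map,
    LinearMap.comp_assoc, LinearMap.comp_assoc]
  split_ifs with h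
  · rw [h.1, h.2, h1, h1, LinearMap.comp_id, LinearMap.comp_id]
  · rcases not_and_or.1 h with h | h <;> rw [h0 h] <;> simp

theorem pair_actTensor_sum_incl₂ (y : ∀ j, Y j) (j k : Fin n)
    (α : TangentSpace (I j) (y j) →L[𝕜] 𝕜) (β : TangentSpace (I k) (y k) →L[𝕜] 𝕜)
    (R : Fin n → Fin n → 𝔤 ⊗[𝕜] 𝔤) :
    pair (ModelWithCorners.pi I) (actTensor (prodAction lam) (∑ j', ∑ k', incl₂ j' k' (R j' k')) y)
        (α ∘L tangentProj I y j) (β ∘L tangentProj I y k) =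
      ev (evalAction (lam j) (y j) α) (evalAction (lam k) (y k) β) (R j k) := by
  have h := pair_actTensor_prodAction_incl₂ lam y j k
  simp only [pair_actTensor, map_sum] at h ⊢
  simp only [h, ite_and]
  simp

theorem pair_prodTensor_self (π : ∀ j, TField₂ (I j) (Y j)) (y : ∀ j, Y j) (j : Fin n)
    (α β : TangentSpace (I j) (y j) →L[𝕜] 𝕜) :
    pair (ModelWithCorners.pi I) (prodTensor π y)
        (α ∘L tangentProj I y j) (β ∘L tangentProj I y j) = pair (I j) (π j (y j)) α β := by
  rw [pair_eq_ev, prodTensor, map_sum, Finset.sum_eq_single j]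
  · have h : (tangentProj I y j).toLinearMap ∘ₗ tangentIncl y j = LinearMap.id :=
      LinearMap.ext (tangentProj_tangentIncl_self y j)
    rw [ev_sq, ContinuousLinearMap.toLinearMap_comp, ContinuousLinearMap.toLinearMap_comp,
      LinearMap.comp_assoc, LinearMap.comp_assoc, h]
    rfl
  · intro i _ hi
    have h : (tangentProj I y j).toLinearMap ∘ₗ tangentIncl y i = 0 :=
      LinearMap.ext (tangentProj_tangentIncl_of_ne y hi.symm)
    rw [ev_sq, ContinuousLinearMap.toLinearMap_comp, LinearMap.comp_assoc, h]
    simp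
  · simp

theorem pair_prodTensor_of_ne (π : ∀ j, TField₂ (I j) (Y j)) (y : ∀ j, Y j) {j k : Fin n}
    (hjk : j ≠ k) (α : TangentSpace (I j) (y j) →L[𝕜] 𝕜)
    (β : TangentSpace (I k) (y k) →L[𝕜] 𝕜) :
    pair (ModelWithCorners.pi I) (prodTensor π y)
        (α ∘L tangentProj I y j) (β ∘L tangentProj I y k) = 0 := by
  rw [pair_eq_ev, prodTensor, map_sum, Finset.sum_eq_zero]
  intro i _
  rw [ev_sq, ContinuousLinearMap.toLinearMap_comp, ContinuousLinearMap.toLinearMap_comp,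
    LinearMap.comp_assoc, LinearMap.comp_assoc]
  rcases eq_or_ne j i with rfl | hi
  · have h : (tangentProj I y k).toLinearMap ∘ₗ tangentIncl y j = 0 :=
      LinearMap.ext (tangentProj_tangentIncl_of_ne y hjk.symm)
    rw [h]
    simp
  · have h : (tangentProj I y j).toLinearMap ∘ₗ tangentIncl y i = 0 :=
      LinearMap.ext (tangentProj_tangentIncl_of_ne y hi)
    rw [h]
    simp

theorem pair_add {E : Type*} [NormedAddCommGroup E] [NormedSpace 𝕜 E]
    {H : Type*} [TopologicalSpace H] {I : ModelWithCorners 𝕜 E H}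
    {M : Type*} [TopologicalSpace M] [ChartedSpace H M] {y : M}
    (t t' : TangentSpace I y ⊗[𝕜] TangentSpace I y) (α β : TangentSpace I y →L[𝕜] 𝕜) :
    pair I (t + t') α β = pair I t α β + pair I t' α β := by
  simp only [pair_eq_ev, map_add]

theorem pair_actTensor_prodAction_Mix (r : 𝔤 ⊗[𝕜] 𝔤) (y : ∀ j, Y j) (j k : Fin n)
    (α : TangentSpace (I j) (y j) →L[𝕜] 𝕜) (β : TangentSpace (I k) (y k) →L[𝕜] 𝕜) :
    pair (ModelWithCorners.pi I) (actTensor (prodAction lam) (Mix 𝕜 n r) y)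
        (α ∘L tangentProj I y j) (β ∘L tangentProj I y k) =
      if j = k then 0 else
        -ev (evalAction (lam j) (y j) α) (evalAction (lam k) (y k) β) (rComp 𝕜 r j k) := by
  have h : Mix 𝕜 n r =
      ∑ j, ∑ k, incl₂ j k (if j = k then 0 else -rComp 𝕜 r j k) := by
    simp only [Mix_eq_sum, ← Finset.sum_neg_distrib]
    refine Finset.sum_congr rfl fun j _ => Finset.sum_congr rfl fun k _ => ?_
    split_ifs <;> simp
  rw [h, pair_actTensor_sum_incl₂]
  split_ifs <;> simp

variable (r : 𝔤 ⊗[𝕜] 𝔤) (π : ∀ j, TField₂ (I j) (Y j))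

theorem pair_fusionTensor_self (y : ∀ j, Y j) (j : Fin n)
    (α β : TangentSpace (I j) (y j) →L[𝕜] 𝕜) :
    pair (ModelWithCorners.pi I) (fusionTensor r π lam y)
        (α ∘L tangentProj I y j) (β ∘L tangentProj I y j) = pair (I j) (π j (y j)) α β := by
  rw [fusionTensor, Pi.add_apply, pair_add, pair_prodTensor_self, pair_actTensor_prodAction_Mix,
    if_pos rfl, add_zero]

theorem pair_fusionTensor_of_ne (y : ∀ j, Y j) {j k : Fin n} (h : j ≠ k)
    (α : TangentSpace (I j) (y j) →L[𝕜] 𝕜) (β : TangentSpace (I k) (y k) →L[𝕜] 𝕜) :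
    pair (ModelWithCorners.pi I) (fusionTensor r π lam y)
        (α ∘L tangentProj I y j) (β ∘L tangentProj I y k) =
      -ev (evalAction (lam j) (y j) α) (evalAction (lam k) (y k) β) (rComp 𝕜 r j k) := by
  rw [fusionTensor, Pi.add_apply, pair_add, pair_prodTensor_of_ne π y h,
    pair_actTensor_prodAction_Mix, if_neg h, zero_add]

theorem flip_sq {V W : Type*} [AddCommGroup V] [Module 𝕜 V] [AddCommGroup W] [Module 𝕜 W]
    (f : V →ₗ[𝕜] W) (t : V ⊗[𝕜] V) : flip 𝕜 (sq 𝕜 f t) = sq 𝕜 f (flip 𝕜 t) := by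
  induction t with
  | zero => simp
  | add a b ha hb => simp only [map_add, ha, hb]
  | tmul u v => simp [flip, sq]

theorem flip_fusionTensor {π : ∀ j, TField₂ (I j) (Y j)}
    (hπ : ∀ j y, flip 𝕜 (π j y) = -π j y) (y : ∀ j, Y j) :
    flip 𝕜 (fusionTensor r π lam y) = -fusionTensor r π lam y := by
  simp only [fusionTensor, Pi.add_apply, prodTensor, actTensor, map_add, map_sum, flip_sq, hπ,
    flip_Mix, map_neg, Finset.sum_neg_distrib, neg_add]

section
variable [∀ j, IsManifold (I j) ∞ (Y j)]

theorem deriv₁_prodAction (x : Fin n → 𝔤) {j : Fin n} {f : Y j → 𝕜} {y : ∀ j, Y j}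
    (hf : MDifferentiableAt (I j) 𝓘(𝕜, 𝕜) f (y j)) :
    deriv₁ (ModelWithCorners.pi I) (prodAction lam x) (fun z => f (z j)) y =
      deriv₁ (I j) (lam j (x j)) f (y j) := by
  rw [deriv₁, mvfderiv_comp_eval hf]
  exact congrArg (mvfderiv (I j) f (y j)) (tangentProj_prodAction lam x y j)

theorem deriv₂_fusionTensor_self {j : Fin n} {f g : Y j → 𝕜} {y : ∀ j, Y j}
    (hf : MDifferentiableAt (I j) 𝓘(𝕜, 𝕜) f (y j)) (hg : MDifferentiableAt (I j) 𝓘(𝕜, 𝕜) g (y j)) :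
    deriv₂ (ModelWithCorners.pi I) (fusionTensor r π lam) (fun z => f (z j)) (fun z => g (z j)) y =
      deriv₂ (I j) (π j) f g (y j) := by
  rw [deriv₂, mvfderiv_comp_eval hf, mvfderiv_comp_eval hg, pair_fusionTensor_self]
  rfl

/-- Writing the block as a finite sum of pure tensors turns the bracket of functions from different
factors into a sum of products, each factor depending on one coordinate, to which the Leibniz rule
applies. -/
theorem deriv₂_fusionTensor_of_ne {j k : Fin n} (h : j ≠ k) {S : Finset (𝔤 × 𝔤)}
    (hS : rComp 𝕜 r j k = ∑ i ∈ S, i.1 ⊗ₜ[𝕜] i.2) {f : Y j → 𝕜} {g : Y k → 𝕜} {y : ∀ j, Y j}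
    (hf : MDifferentiableAt (I j) 𝓘(𝕜, 𝕜) f (y j)) (hg : MDifferentiableAt (I k) 𝓘(𝕜, 𝕜) g (y k)) :
    deriv₂ (ModelWithCorners.pi I) (fusionTensor r π lam) (fun z => f (z j)) (fun z => g (z k)) y =
      -∑ i ∈ S, deriv₁ (I j) (lam j i.1) f (y j) * deriv₁ (I k) (lam k i.2) g (y k) := by
  rw [deriv₂, mvfderiv_comp_eval hf, mvfderiv_comp_eval hg, pair_fusionTensor_of_ne lam r π y h, hS,
    map_sum]
  simp only [ev_tmul]
  rfl

end

end ProductManifold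

/-! ### Smoothness of the fusion product and compatibility with the product action -/

section Fusion

open Set Filter Topology VectorField

variable {𝕜 : Type*} [RCLike 𝕜] {n : ℕ}
  {E : Fin n → Type*} [∀ j, NormedAddCommGroup (E j)] [∀ j, NormedSpace 𝕜 (E j)]
  {H : Fin n → Type*} [∀ j, TopologicalSpace (H j)] {I : ∀ j, ModelWithCorners 𝕜 (E j) (H j)}
  {Y : Fin n → Type*} [∀ j, TopologicalSpace (Y j)] [∀ j, ChartedSpace (H j) (Y j)]
  [∀ j, IsManifold (I j) ∞ (Y j)]
  {𝔤 : Type*} [LieRing 𝔤] [LieAlgebra 𝕜 𝔤]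
  {r : 𝔤 ⊗[𝕜] 𝔤} {π : ∀ j, TField₂ (I j) (Y j)} {lam : ∀ j, 𝔤 →ₗ[𝕜] VField (I j) (Y j)}

omit [∀ j, IsManifold (I j) ∞ (Y j)] in
theorem contMDiffOn_comp_eval {j : Fin n} {f : Y j → 𝕜} {y : ∀ j, Y j}
    (hf : ContMDiffOn (I j) 𝓘(𝕜, 𝕜) ∞ f (chartAt (H j) (y j)).source) :
    ContMDiffOn (ModelWithCorners.pi I) 𝓘(𝕜, 𝕜) ∞ (fun z : ∀ j, Y j => f (z j))
      (chartAt (ModelPi H) y).source :=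
  hf.comp (contMDiff_eval j).contMDiffOn fun _ hz => mem_chartAt_pi_source.1 hz j

theorem contMDiffOn_deriv₂_fusionTensor (r : 𝔤 ⊗[𝕜] 𝔤) (hπ : ∀ j, IsBivector (I j) (π j))
    (hlam : ∀ j, IsLeftAction (I j) (lam j)) (y : ∀ j, Y j) (j k : Fin n)
    (α : TangentSpace (I j) (y j) →L[𝕜] 𝕜) (β : TangentSpace (I k) (y k) →L[𝕜] 𝕜) :
    ContMDiffOn (ModelWithCorners.pi I) 𝓘(𝕜, 𝕜) ∞
      (deriv₂ (ModelWithCorners.pi I) (fusionTensor r π lam)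
        (linFun (ModelWithCorners.pi I) y (α ∘L tangentProj I y j))
        (linFun (ModelWithCorners.pi I) y (β ∘L tangentProj I y k)))
      (chartAt (ModelPi H) y).source := by
  rcases eq_or_ne j k with rfl | h
  · refine (contMDiffOn_comp_eval ((hπ j).smooth (y j) α β)).congr fun z hz => ?_
    have hz := mem_chartAt_pi_source.1 hz j
    rw [linFun_tangentProj, linFun_tangentProj]
    exact deriv₂_fusionTensor_self lam r π (f := linFun (I j) (y j) α) (g := linFun (I j) (y j) β)
      (mdifferentiableAt_linFun hz α) (mdifferentiableAt_linFun hz β)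
  · obtain ⟨S, hS⟩ := exists_eq_sum_tmul (rComp 𝕜 r j k)
    have hs : ContMDiffOn (ModelWithCorners.pi I) 𝓘(𝕜, 𝕜) ∞
        (fun z : ∀ j, Y j => -∑ i ∈ S, deriv₁ (I j) (lam j i.1) (linFun (I j) (y j) α) (z j) *
          deriv₁ (I k) (lam k i.2) (linFun (I k) (y k) β) (z k))
        (chartAt (ModelPi H) y).source := by
      refine ContMDiffOn.neg (contMDiffOn_finsetSum fun i _ => ContMDiffOn.mul ?_ ?_)
      · exact contMDiffOn_comp_eval (contMDiffOn_deriv₁_linFun ((hlam j).smooth i.1) (y j) α)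
      · exact contMDiffOn_comp_eval (contMDiffOn_deriv₁_linFun ((hlam k).smooth i.2) (y k) β)
    refine hs.congr fun z hz => ?_
    have hz := mem_chartAt_pi_source.1 hz
    rw [linFun_tangentProj, linFun_tangentProj]
    exact deriv₂_fusionTensor_of_ne lam r π h hS (f := linFun (I j) (y j) α)
      (g := linFun (I k) (y k) β) (mdifferentiableAt_linFun (hz j) α)
      (mdifferentiableAt_linFun (hz k) β)

theorem isBivector_fusionTensor (r : 𝔤 ⊗[𝕜] 𝔤) (hπ : ∀ j, IsBivector (I j) (π j))
    (hlam : ∀ j, IsLeftAction (I j) (lam j)) :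
    IsBivector (ModelWithCorners.pi I) (fusionTensor r π lam) where
  skew := flip_fusionTensor lam r fun j => (hπ j).skew
  smooth y α β := by
    obtain ⟨a, rfl⟩ := exists_eq_sum_tangentProj y α
    obtain ⟨b, rfl⟩ := exists_eq_sum_tangentProj y β
    have hs : ContMDiffOn (ModelWithCorners.pi I) 𝓘(𝕜, 𝕜) ∞ (fun z => ∑ j, ∑ k,
        deriv₂ (ModelWithCorners.pi I) (fusionTensor r π lam)
          (linFun (ModelWithCorners.pi I) y (a j ∘L tangentProj I y j))
          (linFun (ModelWithCorners.pi I) y (b k ∘L tangentProj I y k)) z)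
        (chartAt (ModelPi H) y).source :=
      contMDiffOn_finsetSum fun j _ => contMDiffOn_finsetSum fun k _ =>
        contMDiffOn_deriv₂_fusionTensor r hπ hlam y j k (a j) (b k)
    refine hs.congr fun z hz => ?_
    simp only [deriv₂_eq, mvfderiv_linFun hz]
    simp only [← LinearMap.sum_apply, ← map_sum, ContinuousLinearMap.finsetSum_comp]

/-- The differential at `y` of the function `z ↦ α(σ(x))`, in the preferred chart at `y`. -/
def actDeriv {E : Type*} [NormedAddCommGroup E] [NormedSpace 𝕜 E]
    {H : Type*} [TopologicalSpace H] {I : ModelWithCorners 𝕜 E H}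
    {M : Type*} [TopologicalSpace M] [ChartedSpace H M] (σ : 𝔤 →ₗ[𝕜] VField I M) (y : M)
    (α : TangentSpace I y →L[𝕜] 𝕜) (x : 𝔤) : TangentSpace I y →L[𝕜] 𝕜 :=
  mvfderiv I (deriv₁ I (σ x) (linFun I y α)) y

/-- The anti-homomorphism property in coordinates. It is how differences of second order terms are
recognised as brackets in `𝔤`. -/
theorem IsLeftAction.actDeriv_sub {E : Type*} [NormedAddCommGroup E] [NormedSpace 𝕜 E]
    [CompleteSpace E] {H : Type*} [TopologicalSpace H] {I : ModelWithCorners 𝕜 E H}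
    {M : Type*} [TopologicalSpace M] [ChartedSpace H M] [IsManifold I ∞ M]
    {σ : 𝔤 →ₗ[𝕜] VField I M} (hσ : IsLeftAction I σ) (y : M)
    (α : TangentSpace I y →L[𝕜] 𝕜) (a b : 𝔤) :
    actDeriv σ y α a (σ b y) - actDeriv σ y α b (σ a y) = α (σ ⁅a, b⁆ y) := by
  have h := deriv₁_mlieBracket (hσ.smooth a) (hσ.smooth b) y α
  rw [hσ.anti, Pi.neg_apply, map_neg, h, neg_sub]
  rfl

theorem mvfderiv_deriv₁_prodAction (hlam : ∀ j, IsLeftAction (I j) (lam j)) (x : Fin n → 𝔤)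
    (y : ∀ j, Y j) (j : Fin n) (α : TangentSpace (I j) (y j) →L[𝕜] 𝕜) :
    mvfderiv (ModelWithCorners.pi I) (deriv₁ (ModelWithCorners.pi I) (prodAction lam x)
        (linFun (ModelWithCorners.pi I) y (α ∘L tangentProj I y j))) y =
      actDeriv (lam j) (y j) α (x j) ∘L tangentProj I y j := by
  refine (mvfderiv_congr ?_).trans (mvfderiv_comp_eval
    (mdifferentiableAt_deriv₁_linFun ((hlam j).smooth (x j)) (y j) α))
  filter_upwards [(chartAt (ModelPi H) y).open_source.mem_nhds (mem_chart_source _ y)] with z hz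
  exact deriv₁_prodAction lam x (f := linFun (I j) (y j) α)
    (mdifferentiableAt_linFun (mem_chartAt_pi_source.1 hz j) α)

theorem mvfderiv_deriv₂_fusionTensor_self (r : 𝔤 ⊗[𝕜] 𝔤) (hπ : ∀ j, IsBivector (I j) (π j))
    (y : ∀ j, Y j) (j : Fin n) (α β : TangentSpace (I j) (y j) →L[𝕜] 𝕜) :
    mvfderiv (ModelWithCorners.pi I) (deriv₂ (ModelWithCorners.pi I) (fusionTensor r π lam)
        (linFun (ModelWithCorners.pi I) y (α ∘L tangentProj I y j))
        (linFun (ModelWithCorners.pi I) y (β ∘L tangentProj I y j))) y =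
      mvfderiv (I j) (deriv₂ (I j) (π j) (linFun (I j) (y j) α) (linFun (I j) (y j) β)) (y j)
        ∘L tangentProj I y j := by
  refine (mvfderiv_congr ?_).trans (mvfderiv_comp_eval
    (mdifferentiableAt_deriv₂_linFun (hπ j) (y j) α β))
  filter_upwards [(chartAt (ModelPi H) y).open_source.mem_nhds (mem_chart_source _ y)] with z hz
  have hz := mem_chartAt_pi_source.1 hz j
  rw [linFun_tangentProj, linFun_tangentProj]
  exact deriv₂_fusionTensor_self lam r π (f := linFun (I j) (y j) α) (g := linFun (I j) (y j) β)
    (mdifferentiableAt_linFun hz α) (mdifferentiableAt_linFun hz β)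

theorem mvfderiv_sum_mul_comp_eval {ι : Type*} (S : Finset ι) {j k : Fin n} {f : ι → Y j → 𝕜}
    {g : ι → Y k → 𝕜} {y : ∀ j, Y j}
    (hf : ∀ i ∈ S, MDifferentiableAt (I j) 𝓘(𝕜, 𝕜) (f i) (y j))
    (hg : ∀ i ∈ S, MDifferentiableAt (I k) 𝓘(𝕜, 𝕜) (g i) (y k)) :
    mvfderiv (ModelWithCorners.pi I) (fun z : ∀ j, Y j => ∑ i ∈ S, f i (z j) * g i (z k)) y =
      ∑ i ∈ S, (f i (y j) • (mvfderiv (I k) (g i) (y k) ∘L tangentProj I y k)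
        + g i (y k) • (mvfderiv (I j) (f i) (y j) ∘L tangentProj I y j)) := by
  rw [mvfderiv_sum S (f := fun i (z : ∀ j, Y j) => f i (z j) * g i (z k)) fun i hi =>
    (mdifferentiableAt_comp_eval (hf i hi)).mul (mdifferentiableAt_comp_eval (hg i hi))]
  refine Finset.sum_congr rfl fun i hi => ?_
  rw [← mvfderiv_comp_eval (hf i hi), ← mvfderiv_comp_eval (hg i hi)]
  exact mvfderiv_fun_mul (mdifferentiableAt_comp_eval (hf i hi))
    (mdifferentiableAt_comp_eval (hg i hi))

theorem mvfderiv_deriv₂_fusionTensor_of_ne (π : ∀ j, TField₂ (I j) (Y j))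
    (hlam : ∀ j, IsLeftAction (I j) (lam j))
    (y : ∀ j, Y j) {j k : Fin n} (h : j ≠ k) {S : Finset (𝔤 × 𝔤)}
    (hS : rComp 𝕜 r j k = ∑ i ∈ S, i.1 ⊗ₜ[𝕜] i.2)
    (α : TangentSpace (I j) (y j) →L[𝕜] 𝕜) (β : TangentSpace (I k) (y k) →L[𝕜] 𝕜) :
    mvfderiv (ModelWithCorners.pi I) (deriv₂ (ModelWithCorners.pi I) (fusionTensor r π lam)
        (linFun (ModelWithCorners.pi I) y (α ∘L tangentProj I y j))
        (linFun (ModelWithCorners.pi I) y (β ∘L tangentProj I y k))) y =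
      -∑ i ∈ S, (α (lam j i.1 (y j)) • (actDeriv (lam k) (y k) β i.2 ∘L tangentProj I y k)
        + β (lam k i.2 (y k)) • (actDeriv (lam j) (y j) α i.1 ∘L tangentProj I y j)) := by
  have e : deriv₂ (ModelWithCorners.pi I) (fusionTensor r π lam)
        (linFun (ModelWithCorners.pi I) y (α ∘L tangentProj I y j))
        (linFun (ModelWithCorners.pi I) y (β ∘L tangentProj I y k)) =ᶠ[𝓝 y]
      fun z => -∑ i ∈ S, deriv₁ (I j) (lam j i.1) (linFun (I j) (y j) α) (z j)
        * deriv₁ (I k) (lam k i.2) (linFun (I k) (y k) β) (z k) := by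
    filter_upwards [(chartAt (ModelPi H) y).open_source.mem_nhds (mem_chart_source _ y)] with z hz
    have hz := mem_chartAt_pi_source.1 hz
    rw [linFun_tangentProj, linFun_tangentProj]
    exact deriv₂_fusionTensor_of_ne lam r π h hS (f := linFun (I j) (y j) α)
      (g := linFun (I k) (y k) β) (mdifferentiableAt_linFun (hz j) α)
      (mdifferentiableAt_linFun (hz k) β)
  rw [mvfderiv_congr e, mvfderiv_fun_neg, mvfderiv_sum_mul_comp_eval S
    (f := fun i => deriv₁ (I j) (lam j i.1) (linFun (I j) (y j) α))
    (g := fun i => deriv₁ (I k) (lam k i.2) (linFun (I k) (y k) β))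
    (fun i _ => mdifferentiableAt_deriv₁_linFun ((hlam j).smooth i.1) (y j) α)
    (fun i _ => mdifferentiableAt_deriv₁_linFun ((hlam k).smooth i.2) (y k) β)]
  simp only [deriv₁_linFun_self]
  rfl

theorem isLeftAction_prodAction [∀ j, FiniteDimensional 𝕜 (E j)]
    (hlam : ∀ j, IsLeftAction (I j) (lam j)) :
    IsLeftAction (ModelWithCorners.pi I) (prodAction lam) := by
  have hd : ∀ (x : Fin n → 𝔤) (y : ∀ j, Y j) (j : Fin n) (α : TangentSpace (I j) (y j) →L[𝕜] 𝕜),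
      ∀ z ∈ (chartAt (ModelPi H) y).source,
      deriv₁ (ModelWithCorners.pi I) (prodAction lam x)
        (linFun (ModelWithCorners.pi I) y (α ∘L tangentProj I y j)) z =
      deriv₁ (I j) (lam j (x j)) (linFun (I j) (y j) α) (z j) := fun x y j α z hz =>
    deriv₁_prodAction lam x (f := linFun (I j) (y j) α)
      (mdifferentiableAt_linFun (mem_chartAt_pi_source.1 hz j) α)
  have hsm : ∀ x, ContMDiff (ModelWithCorners.pi I) (ModelWithCorners.pi I).tangent ∞
      (fun y => (⟨y, prodAction lam x y⟩ : TangentBundle (ModelWithCorners.pi I) (∀ j, Y j))) := by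
    intro x
    refine contMDiff_vectorField_of_deriv₁_linFun fun y α => ?_
    obtain ⟨a, rfl⟩ := exists_eq_sum_tangentProj y α
    have hs : ContMDiffOn (ModelWithCorners.pi I) 𝓘(𝕜, 𝕜) ∞ (fun z : ∀ j, Y j => ∑ j,
        deriv₁ (I j) (lam j (x j)) (linFun (I j) (y j) (a j)) (z j))
        (chartAt (ModelPi H) y).source :=
      contMDiffOn_finsetSum fun j _ =>
        contMDiffOn_comp_eval (contMDiffOn_deriv₁_linFun ((hlam j).smooth (x j)) (y j) (a j))
    refine (hs.congr fun z hz => ?_).contMDiffAt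
      ((chartAt (ModelPi H) y).open_source.mem_nhds (mem_chart_source _ y))
    simp only [← hd x y _ _ z hz, deriv₁_linFun hz, sum_apply]
  refine ⟨hsm, fun x x' => funext fun y => tangentSpace_ext fun j => ?_⟩
  -- Vectors are compared through continuous covectors, so that the bracket formula for derivatives
  -- of functions applies.
  have : SeparatingDual 𝕜 (TangentSpace (I j) (y j)) := inferInstanceAs (SeparatingDual 𝕜 (E j))
  refine (SeparatingDual.eq_iff_forall_dual_eq (R := 𝕜)).2 fun α => ?_
  have := fun j => FiniteDimensional.complete 𝕜 (E j)
  have h := deriv₁_mlieBracket (hsm x) (hsm x') y (α ∘L tangentProj I y j)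
  have h' := (hlam j).actDeriv_sub (y j) α (x j) (x' j)
  rw [deriv₁, deriv₁, mvfderiv_deriv₁_prodAction hlam, mvfderiv_deriv₁_prodAction hlam] at h
  simp only [ContinuousLinearMap.comp_apply, tangentProj_prodAction] at h
  rw [tangentProj_prodAction, Pi.neg_apply, map_neg, map_neg, h, neg_sub]
  exact h'.symm

omit [∀ j, IsManifold (I j) ∞ (Y j)] in
theorem pairₗ_fusionTensor_self (y : ∀ j, Y j) (j : Fin n)
    (α β : TangentSpace (I j) (y j) →L[𝕜] 𝕜) :
    pairₗ (fusionTensor r π lam y) (α ∘L tangentProj I y j) (β ∘L tangentProj I y j) =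
      pairₗ (π j (y j)) α β :=
  pair_fusionTensor_self lam r π y j α β

omit [∀ j, IsManifold (I j) ∞ (Y j)] in
theorem pairₗ_fusionTensor_of_ne (y : ∀ j, Y j) {j k : Fin n} (h : j ≠ k)
    {S : Finset (𝔤 × 𝔤)} (hS : rComp 𝕜 r j k = ∑ i ∈ S, i.1 ⊗ₜ[𝕜] i.2)
    (α : TangentSpace (I j) (y j) →L[𝕜] 𝕜) (β : TangentSpace (I k) (y k) →L[𝕜] 𝕜) :
    pairₗ (fusionTensor r π lam y) (α ∘L tangentProj I y j) (β ∘L tangentProj I y k) =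
      -∑ i ∈ S, α (lam j i.1 (y j)) * β (lam k i.2 (y k)) := by
  rw [pairₗ_apply, pair_fusionTensor_of_ne lam r π y h, hS, map_sum]
  simp only [ev_tmul, evalAction_apply]

omit [∀ j, IsManifold (I j) ∞ (Y j)] in
theorem pair_lie_rPow (r : 𝔤 ⊗[𝕜] 𝔤) (lam : ∀ j, 𝔤 →ₗ[𝕜] VField (I j) (Y j)) (x : Fin n → 𝔤)
    (y : ∀ j, Y j) (j k : Fin n)
    (α : TangentSpace (I j) (y j) →L[𝕜] 𝕜) (β : TangentSpace (I k) (y k) →L[𝕜] 𝕜) :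
    pair (ModelWithCorners.pi I) (actTensor (prodAction lam) ⁅x, rPow 𝕜 n r⁆ y)
        (α ∘L tangentProj I y j) (β ∘L tangentProj I y k) =
      ev (evalAction (lam j) (y j) α) (evalAction (lam k) (y k) β)
        (TensorProduct.map (LieAlgebra.ad 𝕜 𝔤 (x j)) LinearMap.id (rComp 𝕜 r j k)
          + TensorProduct.map LinearMap.id (LieAlgebra.ad 𝕜 𝔤 (x k)) (rComp 𝕜 r j k)) := by
  have h : ⁅x, rPow 𝕜 n r⁆ = ∑ j, ∑ k, incl₂ j k
      (TensorProduct.map (LieAlgebra.ad 𝕜 𝔤 (x j)) LinearMap.id (rComp 𝕜 r j k)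
        + TensorProduct.map LinearMap.id (LieAlgebra.ad 𝕜 𝔤 (x k)) (rComp 𝕜 r j k)) := by
    simp only [rPow_eq_sum, lie_sum, lie_incl₂]
  rw [h, pair_actTensor_sum_incl₂]

/-- On a diagonal block this is compatibility on `Y j`, since `ad` takes the same value on `r` and
on `R j j`. Off the diagonal, the Leibniz rule leaves differences of the form in
`IsLeftAction.actDeriv_sub`, which assemble to `ad (x j) ⊗ 1 + 1 ⊗ ad (x k)` on the block. -/
theorem schouten₁₂_fusionTensor_comp_tangentProj [∀ j, CompleteSpace (E j)]
    (hY : ∀ j, IsLeftPoissonSpace (I j) r (π j) (lam j)) (hr : IsQuasitriangular 𝕜 r)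
    (x : Fin n → 𝔤) (y : ∀ j, Y j) (j k : Fin n)
    (α : TangentSpace (I j) (y j) →L[𝕜] 𝕜) (β : TangentSpace (I k) (y k) →L[𝕜] 𝕜) :
    schouten₁₂ (ModelWithCorners.pi I) (prodAction lam x) (fusionTensor r π lam) y
        (α ∘L tangentProj I y j) (β ∘L tangentProj I y k) =
      pair (ModelWithCorners.pi I) (actTensor (prodAction lam) ⁅x, rPow 𝕜 n r⁆ y)
        (α ∘L tangentProj I y j) (β ∘L tangentProj I y k) := by
  have hlam : ∀ j, IsLeftAction (I j) (lam j) := fun j => (hY j).action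
  have hπ : ∀ j, IsBivector (I j) (π j) := fun j => (hY j).poisson.toIsBivector
  rw [pair_lie_rPow, schouten₁₂_eq, mvfderiv_deriv₁_prodAction hlam,
    mvfderiv_deriv₁_prodAction hlam]
  rcases eq_or_ne j k with rfl | h
  · rw [mvfderiv_deriv₂_fusionTensor_self r hπ, pairₗ_fusionTensor_self, pairₗ_fusionTensor_self,
      ContinuousLinearMap.comp_apply, tangentProj_prodAction, ← lie_eq_map_ad, hr.lie_rComp,
      ← pair_actTensor]
    have := congrFun (congrFun ((hY j).compat (x j) (y j)) α) β
    rw [schouten₁₂_eq] at this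
    exact this
  · obtain ⟨S, hS⟩ := exists_eq_sum_tmul (rComp 𝕜 r j k)
    rw [mvfderiv_deriv₂_fusionTensor_of_ne π hlam y h hS, pairₗ_fusionTensor_of_ne y h hS,
      pairₗ_fusionTensor_of_ne y h hS, hS]
    simp only [map_sum, TensorProduct.map_tmul, map_add, ev_tmul, evalAction_apply, neg_apply,
      sum_apply, add_apply, smul_apply, ContinuousLinearMap.comp_apply, tangentProj_prodAction,
      smul_eq_mul, LieAlgebra.ad_apply, LinearMap.id_apply,
      ← Finset.sum_neg_distrib, ← Finset.sum_add_distrib, ← (hlam _).actDeriv_sub]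
    rw [← Finset.sum_sub_distrib, ← Finset.sum_sub_distrib]
    refine Finset.sum_congr rfl fun i _ => ?_
    ring

end Fusion

/-! ### The Jacobi identity of the fusion product -/

section Jacobi

open Set Filter Topology VectorField

variable {𝕜 : Type*} [RCLike 𝕜] {n : ℕ}
  {E : Fin n → Type*} [∀ j, NormedAddCommGroup (E j)] [∀ j, NormedSpace 𝕜 (E j)]
  {H : Fin n → Type*} [∀ j, TopologicalSpace (H j)] {I : ∀ j, ModelWithCorners 𝕜 (E j) (H j)}
  {Y : Fin n → Type*} [∀ j, TopologicalSpace (Y j)] [∀ j, ChartedSpace (H j) (Y j)]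
  [∀ j, IsManifold (I j) ∞ (Y j)]
  {𝔤 : Type*} [LieRing 𝔤] [LieAlgebra 𝕜 𝔤]
  {r : 𝔤 ⊗[𝕜] 𝔤} {π : ∀ j, TField₂ (I j) (Y j)} {lam : ∀ j, 𝔤 →ₗ[𝕜] VField (I j) (Y j)}

/-- The functional `u ⊗ v ⊗ w ↦ φ u * (ψ v * χ w)`. -/
def ev₃ {V : Type*} [AddCommGroup V] [Module 𝕜 V] (φ ψ χ : V →ₗ[𝕜] 𝕜) :
    V ⊗[𝕜] (V ⊗[𝕜] V) →ₗ[𝕜] 𝕜 :=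
  (TensorProduct.lid 𝕜 𝕜).toLinearMap ∘ₗ TensorProduct.map φ (ev ψ χ)

@[simp]
theorem ev₃_tmul {V : Type*} [AddCommGroup V] [Module 𝕜 V] (φ ψ χ : V →ₗ[𝕜] 𝕜) (u v w : V) :
    ev₃ φ ψ χ (u ⊗ₜ[𝕜] (v ⊗ₜ[𝕜] w)) = φ u * (ψ v * χ w) := by
  simp [ev₃]

theorem ev₃_cyb₃ {A B C : Finset (𝔤 × 𝔤)} {a b c : 𝔤 ⊗[𝕜] 𝔤}
    (ha : a = ∑ i ∈ A, i.1 ⊗ₜ[𝕜] i.2) (hb : b = ∑ i ∈ B, i.1 ⊗ₜ[𝕜] i.2)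
    (hc : c = ∑ i ∈ C, i.1 ⊗ₜ[𝕜] i.2) (φ ψ χ : 𝔤 →ₗ[𝕜] 𝕜) :
    ev₃ φ ψ χ (cyb₃ a b c) =
      ∑ p ∈ A, ∑ q ∈ B, φ ⁅p.1, q.1⁆ * (ψ p.2 * χ q.2)
        + ∑ p ∈ A, ∑ s ∈ C, φ p.1 * (ψ ⁅p.2, s.1⁆ * χ s.2)
        + ∑ q ∈ B, ∑ s ∈ C, φ q.1 * (ψ s.1 * χ ⁅q.2, s.2⁆) := by
  subst ha hb hc
  simp only [cyb₃, map_add, map_sum, LinearMap.sum_apply, br₁₂₁₃_tmul, br₁₂₂₃_tmul, br₁₃₂₃_tmul,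
    ev₃_tmul]
  rw [Finset.sum_comm (s := A) (t := B), Finset.sum_comm (s := A) (t := C),
    Finset.sum_comm (s := B) (t := C)]

theorem sum_mul_sum_comm {R ι κ : Type*} [CommRing R] (s : Finset ι) (t : Finset κ) (u : ι → R)
    (v : ι → κ → R) : ∑ i ∈ s, u i * ∑ k ∈ t, v i k = ∑ k ∈ t, ∑ i ∈ s, u i * v i k := by
  simp only [Finset.mul_sum]
  exact Finset.sum_comm

/-- Here `a x` stands for `α (lam j x)` and `a' x x'` for the derivative of that function along `lam
j x'`; similarly for `b`, `c`. The left side is half the Schouten bracket after the Leibniz rule,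
the right side is minus the Yang-Baxter expression with brackets written as differences. -/
theorem jacobi_sum_of_ne {R ι : Type*} [CommRing R] (A B C : Finset (ι × ι)) (a b c : ι → R)
    (a' b' c' : ι → ι → R) :
    -∑ s ∈ C, (b s.1 * -∑ q ∈ B, a q.1 * c' s.2 q.2 + c s.2 * -∑ p ∈ A, a p.1 * b' s.1 p.2)
      + ∑ q ∈ B, (a q.1 * -∑ s ∈ C, b s.1 * c' q.2 s.2 + c q.2 * ∑ p ∈ A, a' q.1 p.1 * b p.2)
      + -∑ p ∈ A, (a p.1 * ∑ s ∈ C, b' p.2 s.1 * c s.2 + b p.2 * ∑ q ∈ B, a' p.1 q.1 * c q.2) =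
    -(∑ p ∈ A, ∑ q ∈ B, (a' p.1 q.1 - a' q.1 p.1) * (b p.2 * c q.2)
      + ∑ p ∈ A, ∑ s ∈ C, a p.1 * ((b' p.2 s.1 - b' s.1 p.2) * c s.2)
      + ∑ q ∈ B, ∑ s ∈ C, a q.1 * (b s.1 * (c' q.2 s.2 - c' s.2 q.2))) := by
  simp only [Finset.sum_add_distrib, mul_neg, Finset.sum_neg_distrib]
  rw [sum_mul_sum_comm C B, sum_mul_sum_comm C A, sum_mul_sum_comm B A]
  simp only [Finset.mul_sum, ← Finset.sum_neg_distrib, neg_add]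
  have h1 : ∀ p q : ι × ι, -((a' p.1 q.1 - a' q.1 p.1) * (b p.2 * c q.2)) =
    c q.2 * (a' q.1 p.1 * b p.2) + -(b p.2 * (a' p.1 q.1 * c q.2)) := fun p q => by ring
  have h2 : ∀ p s : ι × ι, -(a p.1 * ((b' p.2 s.1 - b' s.1 p.2) * c s.2)) =
    c s.2 * (a p.1 * b' s.1 p.2) + -(a p.1 * (b' p.2 s.1 * c s.2)) := fun p s => by ring
  have h3 : ∀ q s : ι × ι, -(a q.1 * (b s.1 * (c' q.2 s.2 - c' s.2 q.2))) =
    b s.1 * (a q.1 * c' s.2 q.2) + -(a q.1 * (b s.1 * c' q.2 s.2)) := fun q s => by ring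
  simp only [h1, h2, h3, Finset.sum_add_distrib, neg_neg]
  abel

/-- The terms `P` and `Q` are the contributions of `π j`; they cancel against those introduced by
compatibility. The values `a₂ x x'`, `b₂ x x'` stand for the covectors on `lam j ⁅x, x'⁆`. -/
theorem jacobi_sum_of_eq_of_ne {R ι : Type*} [CommRing R] (A B : Finset (ι × ι)) (a b c P Q : ι → R)
    (a₂ b₂ c' : ι → ι → R) :
    -∑ s ∈ B, (b s.1 * -∑ q ∈ B, a q.1 * c' s.2 q.2 + c s.2 * P s.1)
      + ∑ q ∈ B, (a q.1 * -∑ s ∈ B, b s.1 * c' q.2 s.2 + c q.2 * Q q.1)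
      + ∑ q ∈ B, (P q.1 - Q q.1 - ∑ p ∈ A, (a₂ p.1 q.1 * b p.2 + a p.1 * b₂ p.2 q.1)) * c q.2 =
    -(∑ p ∈ A, ∑ q ∈ B, a₂ p.1 q.1 * (b p.2 * c q.2)
      + ∑ p ∈ A, ∑ s ∈ B, a p.1 * (b₂ p.2 s.1 * c s.2)
      + ∑ q ∈ B, ∑ s ∈ B, a q.1 * (b s.1 * (c' q.2 s.2 - c' s.2 q.2))) := by
  have h1 : ∀ q : ι × ι,
      (P q.1 - Q q.1 - ∑ p ∈ A, (a₂ p.1 q.1 * b p.2 + a p.1 * b₂ p.2 q.1)) * c q.2 =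
        c q.2 * P q.1 - c q.2 * Q q.1
          - ∑ p ∈ A, (a₂ p.1 q.1 * (b p.2 * c q.2) + a p.1 * (b₂ p.2 q.1 * c q.2)) := by
    intro q
    simp only [sub_mul, Finset.sum_mul, add_mul, mul_assoc, mul_comm (c q.2)]
  have h2 : ∀ q s : ι × ι, a q.1 * (b s.1 * (c' q.2 s.2 - c' s.2 q.2)) =
    a q.1 * (b s.1 * c' q.2 s.2) - b s.1 * (a q.1 * c' s.2 q.2) := fun q s => by ring
  simp only [h1, h2]
  simp only [Finset.sum_add_distrib, Finset.sum_sub_distrib, mul_neg, Finset.sum_neg_distrib]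
  rw [sum_mul_sum_comm B B fun s => b s.1, Finset.sum_comm (s := B) (t := A),
    Finset.sum_comm (s := B) (t := A)]
  simp only [Finset.mul_sum]
  abel

theorem schouten₂₂_fusionTensor_of_eq
    (hY : ∀ j, IsLeftPoissonSpace (I j) r (π j) (lam j))
    (y : ∀ j, Y j) (j : Fin n) (α β γ : TangentSpace (I j) (y j) →L[𝕜] 𝕜) :
    schouten₂₂ (ModelWithCorners.pi I) (fusionTensor r π lam) (fusionTensor r π lam) y
        (α ∘L tangentProj I y j) (β ∘L tangentProj I y j) (γ ∘L tangentProj I y j) = 0 := by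
  have hπ : ∀ j, IsBivector (I j) (π j) := fun j => (hY j).poisson.toIsBivector
  have h := congrFun (congrFun (congrFun ((hY j).poisson.schouten_eq_zero (y j)) α) β) γ
  rw [schouten₂₂_self_eq] at h ⊢
  simp only [mvfderiv_deriv₂_fusionTensor_self r hπ, pairₗ_fusionTensor_self]
  exact h

theorem schouten₂₂_fusionTensor_of_ne [∀ j, CompleteSpace (E j)]
    (hlam : ∀ j, IsLeftAction (I j) (lam j)) (π : ∀ j, TField₂ (I j) (Y j))
    (hπ : ∀ j y, flip 𝕜 (π j y) = -π j y)
    (hr : IsQuasitriangular 𝕜 r) (y : ∀ j, Y j) {j k l : Fin n} (hjk : j ≠ k) (hkl : k ≠ l)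
    (hjl : j ≠ l) (α : TangentSpace (I j) (y j) →L[𝕜] 𝕜) (β : TangentSpace (I k) (y k) →L[𝕜] 𝕜)
    (γ : TangentSpace (I l) (y l) →L[𝕜] 𝕜) :
    schouten₂₂ (ModelWithCorners.pi I) (fusionTensor r π lam) (fusionTensor r π lam) y
        (α ∘L tangentProj I y j) (β ∘L tangentProj I y k) (γ ∘L tangentProj I y l) = 0 := by
  have hskew := flip_fusionTensor lam r hπ
  obtain ⟨A, hA⟩ := exists_eq_sum_tmul (rComp 𝕜 r j k)
  obtain ⟨B, hB⟩ := exists_eq_sum_tmul (rComp 𝕜 r j l)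
  obtain ⟨C, hC⟩ := exists_eq_sum_tmul (rComp 𝕜 r k l)
  have h0 := congrArg (ev₃ (evalAction (lam j) (y j) α) (evalAction (lam k) (y k) β)
    (evalAction (lam l) (y l) γ)) (hr.cyb₃_rComp j k l)
  rw [ev₃_cyb₃ hA hB hC, map_zero] at h0
  simp only [evalAction_apply, ← (hlam _).actDeriv_sub] at h0
  have hpair : ∀ {a b : Fin n} (φ : TangentSpace (I a) (y a) →L[𝕜] 𝕜)
      (ψ : TangentSpace (I b) (y b) →L[𝕜] 𝕜),
      pairₗ (fusionTensor r π lam y) (φ ∘L tangentProj I y a) (ψ ∘L tangentProj I y b) =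
        -pairₗ (fusionTensor r π lam y) (ψ ∘L tangentProj I y b) (φ ∘L tangentProj I y a) :=
    fun φ ψ => pair_skew (hskew y) _ _
  -- Skewness reorders the pair `γ, α`, so that only the blocks `j k`, `j l`, `k l` of the
  -- Yang-Baxter expression occur.
  rw [schouten₂₂_self_eq, deriv₂_skew hskew (linFun _ y (γ ∘L _)), mvfderiv_neg,
    mvfderiv_deriv₂_fusionTensor_of_ne π hlam y hkl hC,
    mvfderiv_deriv₂_fusionTensor_of_ne π hlam y hjl hB,
    mvfderiv_deriv₂_fusionTensor_of_ne π hlam y hjk hA]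
  simp only [map_neg, map_sum, map_add, map_smul, neg_neg]
  simp only [hpair β (actDeriv (lam j) _ _ _), hpair γ (actDeriv (lam j) _ _ _),
    hpair γ (actDeriv (lam k) _ _ _),
    pairₗ_fusionTensor_of_ne y hjk hA, pairₗ_fusionTensor_of_ne y hjl hB,
    pairₗ_fusionTensor_of_ne y hkl hC]
  simp only [smul_eq_mul, neg_neg]
  rw [jacobi_sum_of_ne A B C (fun x => α (lam j x (y j))) (fun x => β (lam k x (y k)))
    (fun x => γ (lam l x (y l))) (fun x x' => actDeriv (lam j) (y j) α x (lam j x' (y j)))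
    (fun x x' => actDeriv (lam k) (y k) β x (lam k x' (y k)))
    (fun x x' => actDeriv (lam l) (y l) γ x (lam l x' (y l))), h0, neg_zero, mul_zero]

/-- Differentiating `π j` along the action is where compatibility enters the Jacobi identity: it
supplies the terms of the mixed Yang-Baxter equation for `j, j, l` that contain the diagonal block.
-/
theorem schouten₂₂_fusionTensor_of_eq_of_ne [∀ j, CompleteSpace (E j)]
    (hY : ∀ j, IsLeftPoissonSpace (I j) r (π j) (lam j))
    (hr : IsQuasitriangular 𝕜 r) (y : ∀ j, Y j) {j l : Fin n}
    (hjl : j ≠ l) (α β : TangentSpace (I j) (y j) →L[𝕜] 𝕜)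
    (γ : TangentSpace (I l) (y l) →L[𝕜] 𝕜) :
    schouten₂₂ (ModelWithCorners.pi I) (fusionTensor r π lam) (fusionTensor r π lam) y
        (α ∘L tangentProj I y j) (β ∘L tangentProj I y j) (γ ∘L tangentProj I y l) = 0 := by
  have hlam : ∀ j, IsLeftAction (I j) (lam j) := fun j => (hY j).action
  have hπ : ∀ j, IsBivector (I j) (π j) := fun j => (hY j).poisson.toIsBivector
  have hskew := flip_fusionTensor lam r fun j => (hπ j).skew
  obtain ⟨A, hA⟩ := exists_eq_sum_tmul (rComp 𝕜 r j j)
  obtain ⟨B, hB⟩ := exists_eq_sum_tmul (rComp 𝕜 r j l)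
  have h0 := congrArg (ev₃ (evalAction (lam j) (y j) α) (evalAction (lam j) (y j) β)
    (evalAction (lam l) (y l) γ)) (hr.cyb₃_rComp j j l)
  rw [ev₃_cyb₃ hA hB hB, map_zero] at h0
  simp only [evalAction_apply, ← (hlam l).actDeriv_sub] at h0
  have hpair : ∀ {a b : Fin n} (φ : TangentSpace (I a) (y a) →L[𝕜] 𝕜)
      (ψ : TangentSpace (I b) (y b) →L[𝕜] 𝕜),
      pairₗ (fusionTensor r π lam y) (φ ∘L tangentProj I y a) (ψ ∘L tangentProj I y b) =
        -pairₗ (fusionTensor r π lam y) (ψ ∘L tangentProj I y b) (φ ∘L tangentProj I y a) :=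
    fun φ ψ => pair_skew (hskew y) _ _
  have hcompat : ∀ x, mvfderiv (I j) (deriv₂ (I j) (π j) (linFun (I j) (y j) α)
        (linFun (I j) (y j) β)) (y j) (lam j x (y j)) =
      pairₗ (π j (y j)) α (actDeriv (lam j) (y j) β x)
        - pairₗ (π j (y j)) β (actDeriv (lam j) (y j) α x)
        - ∑ p ∈ A, (α (lam j ⁅p.1, x⁆ (y j)) * β (lam j p.2 (y j))
          + α (lam j p.1 (y j)) * β (lam j ⁅p.2, x⁆ (y j))) := by
    intro x
    have h1 := congrFun (congrFun ((hY j).compat x (y j)) α) β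
    have h2 : pairₗ (π j (y j)) β (actDeriv (lam j) (y j) α x) =
        -pairₗ (π j (y j)) (actDeriv (lam j) (y j) α x) β := pair_skew ((hπ j).skew _) _ _
    -- Compatibility is stated with `ad_x r`; it is rewritten with the block `R j j`, whose
    -- decomposition `A` occurs in `h0`.
    rw [schouten₁₂_eq, pair_actTensor, cobracket, ← hr.lie_rComp x j j, hA, lie_sum, map_sum] at h1
    have h3 : ∀ p : 𝔤 × 𝔤, ev (evalAction (lam j) (y j) α) (evalAction (lam j) (y j) β)
        ⁅x, p.1 ⊗ₜ[𝕜] p.2⁆ = -(α (lam j ⁅p.1, x⁆ (y j)) * β (lam j p.2 (y j))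
          + α (lam j p.1 (y j)) * β (lam j ⁅p.2, x⁆ (y j))) := by
      intro p
      simp only [TensorProduct.LieModule.lie_tmul_right, ← lie_skew x, TensorProduct.neg_tmul,
        TensorProduct.tmul_neg, map_add, map_neg, ev_tmul, neg_add, evalAction_apply]
    rw [Finset.sum_congr rfl fun p _ => h3 p, Finset.sum_neg_distrib] at h1
    rw [h2]
    unfold actDeriv
    linear_combination h1
  rw [schouten₂₂_self_eq, deriv₂_skew hskew (linFun _ y (γ ∘L _)), mvfderiv_neg,
    mvfderiv_deriv₂_fusionTensor_of_ne π hlam y hjl hB,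
    mvfderiv_deriv₂_fusionTensor_of_ne π hlam y hjl hB,
    mvfderiv_deriv₂_fusionTensor_self r hπ]
  simp only [map_neg, map_sum, map_add, map_smul, neg_neg]
  simp only [hpair γ, pairₗ_fusionTensor_of_ne y hjl hB, pairₗ_fusionTensor_self, hcompat]
  simp only [smul_eq_mul, neg_neg]
  rw [jacobi_sum_of_eq_of_ne A B (fun x => α (lam j x (y j))) (fun x => β (lam j x (y j)))
    (fun x => γ (lam l x (y l))) (fun x => pairₗ (π j (y j)) α (actDeriv (lam j) (y j) β x))
    (fun x => pairₗ (π j (y j)) β (actDeriv (lam j) (y j) α x))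
    (fun x x' => α (lam j ⁅x, x'⁆ (y j))) (fun x x' => β (lam j ⁅x, x'⁆ (y j)))
    (fun x x' => actDeriv (lam l) (y l) γ x (lam l x' (y l))), h0, neg_zero, mul_zero]

theorem isPoisson_fusionTensor [∀ j, CompleteSpace (E j)]
    (hY : ∀ j, IsLeftPoissonSpace (I j) r (π j) (lam j)) (hr : IsQuasitriangular 𝕜 r) :
    IsPoisson (ModelWithCorners.pi I) (fusionTensor r π lam) := by
  have hlam : ∀ j, IsLeftAction (I j) (lam j) := fun j => (hY j).action
  have hπ : ∀ j, IsBivector (I j) (π j) := fun j => (hY j).poisson.toIsBivector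
  have hbi := isBivector_fusionTensor r hπ hlam
  refine ⟨hbi, fun y => funext fun α => funext fun β => funext fun γ => ?_⟩
  have hsum : ∀ (a : ∀ j, TangentSpace (I j) (y j) →L[𝕜] 𝕜) (β γ),
      schouten₂₂ (ModelWithCorners.pi I) (fusionTensor r π lam) (fusionTensor r π lam) y
        (∑ j, a j ∘L tangentProj I y j) β γ = ∑ j,
      schouten₂₂ (ModelWithCorners.pi I) (fusionTensor r π lam) (fusionTensor r π lam) y
        (a j ∘L tangentProj I y j) β γ := fun a β γ =>
    map_sum (AddMonoidHom.mk' (fun α => schouten₂₂ (ModelWithCorners.pi I) (fusionTensor r π lam)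
      (fusionTensor r π lam) y α β γ) fun α α' => schouten₂₂_add_left hbi y α α' β γ) _ _
  obtain ⟨a, rfl⟩ := exists_eq_sum_tangentProj y α
  obtain ⟨b, rfl⟩ := exists_eq_sum_tangentProj y β
  obtain ⟨c, rfl⟩ := exists_eq_sum_tangentProj y γ
  rw [hsum]
  refine Finset.sum_eq_zero fun j _ => ?_
  rw [schouten₂₂_cyclic, hsum]
  refine Finset.sum_eq_zero fun k _ => ?_
  rw [schouten₂₂_cyclic, hsum]
  refine Finset.sum_eq_zero fun l _ => ?_
  rw [schouten₂₂_cyclic]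
  -- If exactly two indices agree, a cyclic rotation brings them to the first two slots.
  rcases eq_or_ne j k with rfl | hjk
  · rcases eq_or_ne j l with rfl | hjl
    · exact schouten₂₂_fusionTensor_of_eq hY y j _ _ _
    · exact schouten₂₂_fusionTensor_of_eq_of_ne hY hr y hjl _ _ _
  · rcases eq_or_ne k l with rfl | hkl
    · rw [schouten₂₂_cyclic]
      exact schouten₂₂_fusionTensor_of_eq_of_ne hY hr y hjk.symm _ _ _
    · rcases eq_or_ne j l with rfl | hjl
      · rw [← schouten₂₂_cyclic]
        exact schouten₂₂_fusionTensor_of_eq_of_ne hY hr y hjk _ _ _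
      · exact schouten₂₂_fusionTensor_of_ne hlam π (fun j => (hπ j).skew) hr y hjk hkl hjl _ _ _

end Jacobi

/-! ### Assembling the three claims -/

section PoissonSpace

variable {𝕜 : Type*} [RCLike 𝕜] {n : ℕ}
  {E : Fin n → Type*} [∀ j, NormedAddCommGroup (E j)] [∀ j, NormedSpace 𝕜 (E j)]
  {H : Fin n → Type*} [∀ j, TopologicalSpace (H j)] {I : ∀ j, ModelWithCorners 𝕜 (E j) (H j)}
  {Y : Fin n → Type*} [∀ j, TopologicalSpace (Y j)] [∀ j, ChartedSpace (H j) (Y j)]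
  {𝔤 : Type*} [LieRing 𝔤] [LieAlgebra 𝕜 𝔤]
  {r : 𝔤 ⊗[𝕜] 𝔤} {π : ∀ j, TField₂ (I j) (Y j)} {lam : ∀ j, 𝔤 →ₗ[𝕜] VField (I j) (Y j)}

theorem schouten₁₂_fusionTensor [∀ j, IsManifold (I j) ∞ (Y j)] [∀ j, FiniteDimensional 𝕜 (E j)]
    (hY : ∀ j, IsLeftPoissonSpace (I j) r (π j) (lam j)) (hr : IsQuasitriangular 𝕜 r)
    (x : Fin n → 𝔤) (y : ∀ j, Y j) :
    schouten₁₂ (ModelWithCorners.pi I) (prodAction lam x) (fusionTensor r π lam) y =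
      pair (ModelWithCorners.pi I) (actTensor (prodAction lam) ⁅x, rPow 𝕜 n r⁆ y) := by
  have := fun j => FiniteDimensional.complete 𝕜 (E j)
  have hlam : ∀ j, IsLeftAction (I j) (lam j) := fun j => (hY j).action
  have hbi := isBivector_fusionTensor r (fun j => (hY j).poisson.toIsBivector) hlam
  have hX := (isLeftAction_prodAction hlam).smooth x
  funext α β
  obtain ⟨a, rfl⟩ := exists_eq_sum_tangentProj y α
  obtain ⟨b, rfl⟩ := exists_eq_sum_tangentProj y β
  have hl : ∀ β, schouten₁₂ (ModelWithCorners.pi I) (prodAction lam x) (fusionTensor r π lam) y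
        (∑ j, a j ∘L tangentProj I y j) β = ∑ j,
      schouten₁₂ (ModelWithCorners.pi I) (prodAction lam x) (fusionTensor r π lam) y
        (a j ∘L tangentProj I y j) β := fun β =>
    map_sum (AddMonoidHom.mk' (fun α => schouten₁₂ (ModelWithCorners.pi I) (prodAction lam x)
      (fusionTensor r π lam) y α β) fun α α' => schouten₁₂_add_left hX hbi y α α' β) _ _
  have hr' : ∀ α, schouten₁₂ (ModelWithCorners.pi I) (prodAction lam x) (fusionTensor r π lam) y
        α (∑ j, b j ∘L tangentProj I y j) = ∑ j,
      schouten₁₂ (ModelWithCorners.pi I) (prodAction lam x) (fusionTensor r π lam) y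
        α (b j ∘L tangentProj I y j) := fun α =>
    map_sum (AddMonoidHom.mk' (fun β => schouten₁₂ (ModelWithCorners.pi I) (prodAction lam x)
      (fusionTensor r π lam) y α β) fun β β' => schouten₁₂_add_right hX hbi y α β β') _ _
  rw [hl, ← pairₗ_apply, LinearMap.map_sum₂]
  refine Finset.sum_congr rfl fun j _ => ?_
  rw [hr', map_sum]
  exact Finset.sum_congr rfl fun k _ =>
    schouten₁₂_fusionTensor_comp_tangentProj hY hr x y j k (a j) (b k)

/-- The fusion product of left `(𝔤, r)`-Poisson spaces is a left `(𝔤ⁿ, r⁽ⁿ⁾)`-Poisson space. -/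
theorem isLeftPoissonSpace_fusionTensor [∀ j, IsManifold (I j) ∞ (Y j)]
    [∀ j, FiniteDimensional 𝕜 (E j)]
    (hY : ∀ j, IsLeftPoissonSpace (I j) r (π j) (lam j)) (hr : IsQuasitriangular 𝕜 r) :
    IsLeftPoissonSpace (ModelWithCorners.pi I) (rPow 𝕜 n r) (fusionTensor r π lam)
      (prodAction lam) where
  quasitriangular := hr.rPow n
  poisson := by
    have := fun j => FiniteDimensional.complete 𝕜 (E j)
    exact isPoisson_fusionTensor hY hr
  action := isLeftAction_prodAction fun j => (hY j).action
  compat x y := schouten₁₂_fusionTensor hY hr x y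

theorem actTensor_comp {E : Type*} [NormedAddCommGroup E] [NormedSpace 𝕜 E]
    {H : Type*} [TopologicalSpace H] {I : ModelWithCorners 𝕜 E H}
    {M : Type*} [TopologicalSpace M] [ChartedSpace H M] {𝔥 : Type*} [LieRing 𝔥] [LieAlgebra 𝕜 𝔥]
    (σ : 𝔥 →ₗ[𝕜] VField I M) (f : 𝔤 →ₗ[𝕜] 𝔥) (t : 𝔤 ⊗[𝕜] 𝔤) :
    actTensor (σ ∘ₗ f) t = actTensor σ (sq 𝕜 f t) := by
  funext y
  simp only [actTensor, sq, ← LinearMap.comp_assoc, TensorProduct.map_comp, LinearMap.comp_apply]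

/-- The fusion product of left `(𝔤, r)`-Poisson spaces is a left `(𝔤, r)`-Poisson space for the
diagonal action. -/
theorem isLeftPoissonSpace_fusionTensor_diag [∀ j, IsManifold (I j) ∞ (Y j)]
    [∀ j, FiniteDimensional 𝕜 (E j)]
    (hY : ∀ j, IsLeftPoissonSpace (I j) r (π j) (lam j)) (hr : IsQuasitriangular 𝕜 r) :
    IsLeftPoissonSpace (ModelWithCorners.pi I) r (fusionTensor r π lam)
      (prodAction lam ∘ₗ diag 𝕜 n) where
  quasitriangular := hr
  poisson := (isLeftPoissonSpace_fusionTensor hY hr).poisson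
  action :=
    have h := isLeftAction_prodAction fun j => (hY j).action
    ⟨fun x => h.smooth (diag 𝕜 n x), fun x x' => h.anti (diag 𝕜 n x) (diag 𝕜 n x')⟩
  compat x y := by
    rw [actTensor_comp, cobracket, ← hr.lie_diag_rPow]
    exact schouten₁₂_fusionTensor hY hr (diag 𝕜 n x) y

theorem prodAction_incl (lam : ∀ j, 𝔤 →ₗ[𝕜] VField (I j) (Y j)) (y : ∀ j, Y j) (j : Fin n)
    (x : 𝔤) : prodAction lam (incl 𝕜 j x) y = tangentIncl y j (lam j x (y j)) := by
  refine tangentSpace_ext fun k => ?_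
  rw [tangentProj_prodAction]
  rcases eq_or_ne k j with rfl | h
  · simp [tangentProj_tangentIncl_self, incl]
  · simp [tangentProj_tangentIncl_of_ne y h, incl, h]

theorem actTensor_prodAction_Alt (r : 𝔤 ⊗[𝕜] 𝔤) (lam : ∀ j, 𝔤 →ₗ[𝕜] VField (I j) (Y j)) :
    actTensor (prodAction lam) (Alt 𝕜 n r) =
      prodTensor fun j => actTensor (lam j) (rComp 𝕜 r j j) := by
  funext y
  have h : ∀ j, (LinearMap.proj y ∘ₗ prodAction lam) ∘ₗ incl 𝕜 j =
      tangentIncl y j ∘ₗ LinearMap.proj (y j) ∘ₗ lam j := fun j =>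
    LinearMap.ext (prodAction_incl lam y j)
  simp only [Alt_eq_sum, prodTensor, actTensor, map_sum]
  refine Finset.sum_congr rfl fun j _ => ?_
  simp only [sq, incl₂, ← LinearMap.comp_apply, ← TensorProduct.map_comp, h]

/-- The mixed terms agree by definition. On the diagonal, `lam j (R j j) = -π j` for either value of
the block. -/
theorem fusionTensor_eq_neg_actTensor (hπ : ∀ j y, flip 𝕜 (π j y) = -π j y)
    (h : ∀ j, π j = -actTensor (lam j) r) :
    fusionTensor r π lam = -actTensor (prodAction lam) (rPow 𝕜 n r) := by
  have hj : ∀ j, actTensor (lam j) (rComp 𝕜 r j j) = -π j := by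
    intro j
    rcases rComp_eq_or r j j with e | e <;> rw [e]
    · rw [h, neg_neg]
    · funext y
      -- Skewness of `π j` says that `lam j (r²¹) = -lam j (r)`, so a block `-r²¹` acts as `r` does.
      have := hπ j y
      rw [h, Pi.neg_apply, map_neg, neg_neg, actTensor, flip_sq] at this
      rw [actTensor, map_neg, h, neg_neg, this]
      rfl
  funext y
  have hA := congrFun (actTensor_prodAction_Alt r lam) y
  simp only [hj, prodTensor, Pi.neg_apply, map_neg, Finset.sum_neg_distrib] at hA
  simp only [fusionTensor, prodTensor, Pi.add_apply, Pi.neg_apply, rPow]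
  simp only [actTensor, map_sub] at hA ⊢
  rw [hA]
  abel

end PoissonSpace
end PoissonFusion

end

open PoissonFusion in
theorem mainTheorem4 {𝕜 : Type*} [RCLike 𝕜]
    {𝔤 : Type*} [LieRing 𝔤] [LieAlgebra 𝕜 𝔤] [FiniteDimensional 𝕜 𝔤]
    (r : 𝔤 ⊗[𝕜] 𝔤) (hr : IsQuasitriangular 𝕜 r) (n : ℕ)
    {E : Fin n → Type*} [∀ j, NormedAddCommGroup (E j)] [∀ j, NormedSpace 𝕜 (E j)]
    [∀ j, FiniteDimensional 𝕜 (E j)]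
    {Y : Fin n → Type*} [∀ j, TopologicalSpace (Y j)] [∀ j, ChartedSpace (E j) (Y j)]
    [∀ j, IsManifold 𝓘(𝕜, E j) ∞ (Y j)]
    (π : ∀ j, TField₂ 𝓘(𝕜, E j) (Y j)) (lam : ∀ j, 𝔤 →ₗ[𝕜] VField 𝓘(𝕜, E j) (Y j))
    (hY : ∀ j, IsLeftPoissonSpace 𝓘(𝕜, E j) r (π j) (lam j)) :
    IsLeftPoissonSpace (ModelWithCorners.pi fun j => 𝓘(𝕜, E j))
        (rPow 𝕜 n r) (fusionTensor r π lam) (prodAction lam) ∧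
      IsLeftPoissonSpace (ModelWithCorners.pi fun j => 𝓘(𝕜, E j))
        r (fusionTensor r π lam) (prodAction lam ∘ₗ diag 𝕜 n) ∧
      ((∀ j, π j = -actTensor (lam j) r) →
        fusionTensor r π lam = -actTensor (prodAction lam) (rPow 𝕜 n r)) :=
  ⟨isLeftPoissonSpace_fusionTensor hY hr, isLeftPoissonSpace_fusionTensor_diag hY hr,
    fusionTensor_eq_neg_actTensor fun j => (hY j).poisson.skew⟩
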